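/- Let $N\ge 2$, let $X=\{X_1,\dots,X_m\}$ be locally Lipschitz vector fields on $\mathbb R^N$, $X_j=\sum_k c_{jk}\partial_{x_k}$, and write $Xu=(X_1u,\dots,X_mu)$. Let $\Omega\subset\mathbb R^N$ be open and bounded and let $U\subset\mathbb R^N$ be open with $\overline\Omega\subset U$ (for instance $U=\mathbb R^N$). For $x,y\in U$ let $d_X(x,y)$ be the infimum of the $T>0$ for which there is an absolutely continuous path $\gamma:[0,T]\to U$ with $\gamma(0)=x$, $\gamma(T)=y$ and, for a.e. $t$, $\dot\gamma(t)=\sum_j\theta_j(t)X_j(\gamma(t))$ with $\sum_j\theta_j(t)^2\le 1$; let $B_r(x)=\{y\in U: d_X(x,y)<r\}$. Let $Q>2$ and assume: * $d_X$ is finite on $U$, and $d_X(x,y)\to 0$ as $|y-x|\to0$, for every $x\in U$; * $0<|B_{2r}(x)|\le 2^Q|B_r(x)|$ for all $x\in\Omega$, $r>0$, where $|\cdot|$ is Lebesgue measure; * there are $C_P,\nu>0$ such that, for all $x\in\Omega$, $r>0$ and $u\in C^1_c(\mathbb R^N)$, with $u_B$ denoting the mean of $u$ on $B$, $$\frac1{|B_r(x)|}\int_{B_r(x)}|u-u_{B_r(x)}|\le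 C_P\,r\,\frac1{|B_{\nu r}(x)|}\int_{B_{\nu r}(x)}|Xu| .$$ Let $W^{1,q}_0(\Omega,X)$ be the space of the $u\in L^q(\Omega)$ for which there are $\varphi_n\in C_c^\infty(\Omega)$ and $g\in L^q(\Omega)^m$ with $\varphi_n\to u$ and $X\varphi_n\to g=:Xu$ in $L^q(\Omega)$. Let $0<\alpha<\beta$ and let $A$ be a bounded measurable $m\times m$ matrix field on $\Omega$ (not necessarily symmetric) with $\alpha|\eta|^2\le A(x)\eta\cdot\eta\le\beta|\eta|^2$ for a.e. $x\in\Omega$ and all $\eta\in\mathbb R^m$. Consider the problem $$X^*(A(x)Xu)=f\ \text{ in }\Omega,\qquad u=0\ \text{ on }\partial\Omega. \tag{P}$$ With $T_n(s)=\max(-n,\min(s,n))$, a function $u$ is called a solution of (P) found by approximation if there are weak solutions $u_n\in W^{1,2}_0(\Omega,X)$ of (P) with datum $T_n(f)$, i.e. $\int_\Omega A\,Xu_n\cdot Xv=\int_\Omega T_n(f)\,v$ for all $v\in W^{1,2}_0(\Omega,X)$, such that a subsequence of $(u_n)$ converges to $u$ strongly in $L^s(\Omega)$ for every $1\le s<\frac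 Q{Q-2}$ and weakly in $W^{1,q}_0(\Omega,X)$ for every $1\le q<\frac Q{Q-1}$. **Theorem.** Let $1<p<\frac{2Q}{Q+2}$ and $p^{**}=\frac{pQ}{Q-2p}$. For every $f\in L^p(\Omega)$ the problem (P) has one and (up to a.e. equality) only one solution $u$ found by approximation; it belongs to $L^{p^{**}}(\Omega)$ and $$\|u\|_{L^{p^{**}}(\Omega)}\le C\,\|f\|_{L^p(\Omega)},$$ where $C$ depends only on $Q$, $\Omega$, $p$, $\alpha$ and the geometric setting $(N,m,X,U)$, and not on $\beta$, $A$, $f$ or $u$. -/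

import Mathlib

open MeasureTheory Filter Topology
open scoped ENNReal NNReal

noncomputable section

namespace XElliptic

variable {N m : ℕ}

/-! ### Vector fields and the Carnot-Caratheodory distance -/

/-- `γ : [0, T] → U` is an `X`-subunit path: it is absolutely continuous and, for almost every
`t`, `γ'(t) = ∑ θ_j X_j(γ(t))` for some coefficients with `∑ θ_j ^ 2 ≤ 1`. -/
structure IsSubunit (U : Set (EuclideanSpace ℝ (Fin N)))
    (X : Fin m → EuclideanSpace ℝ (Fin N) → EuclideanSpace ℝ (Fin N))
    (T : ℝ) (γ : ℝ → EuclideanSpace ℝ (Fin N)) : Prop where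
  mem : ∀ t ∈ Set.Icc 0 T, γ t ∈ U
  absCont : AbsolutelyContinuousOnInterval γ 0 T
  subunit : ∀ᵐ t ∂(volume.restrict (Set.Icc 0 T)),
    ∃ θ : Fin m → ℝ, ∑ j, θ j ^ 2 ≤ 1 ∧ HasDerivAt γ (∑ j, θ j • X j (γ t)) t

/-- The control distance `d_X` in the open set `U`: the infimum of the times `T > 0` for which
an `X`-subunit path `[0, T] → U` joins the two points (`⊤` if there is none). -/
def ccDist (U : Set (EuclideanSpace ℝ (Fin N)))
    (X : Fin m → EuclideanSpace ℝ (Fin N) → EuclideanSpace ℝ (Fin N))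
    (x y : EuclideanSpace ℝ (Fin N)) : ℝ≥0∞ :=
  sInf {τ : ℝ≥0∞ | ∃ T : ℝ, 0 < T ∧ τ = ENNReal.ofReal T ∧
    ∃ γ : ℝ → EuclideanSpace ℝ (Fin N), IsSubunit U X T γ ∧ γ 0 = x ∧ γ T = y}

/-- The `d_X`-ball of centre `x` and radius `r`. -/
def ccBall (U : Set (EuclideanSpace ℝ (Fin N)))
    (X : Fin m → EuclideanSpace ℝ (Fin N) → EuclideanSpace ℝ (Fin N))
    (x : EuclideanSpace ℝ (Fin N)) (r : ℝ) : Set (EuclideanSpace ℝ (Fin N)) :=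
  {y | ccDist U X x y < ENNReal.ofReal r}

/-- The `X`-gradient `(X_1 φ, …, X_m φ)` of a `C¹` function, where
`X_j φ (x) = ∑ k, c_{jk}(x) ∂_k φ (x)` and `X j x = (c_{j1}(x), …, c_{jN}(x))`. -/
def xGrad (X : Fin m → EuclideanSpace ℝ (Fin N) → EuclideanSpace ℝ (Fin N))
    (φ : EuclideanSpace ℝ (Fin N) → ℝ) (x : EuclideanSpace ℝ (Fin N)) :
    EuclideanSpace ℝ (Fin m) :=
  WithLp.toLp 2 (fun j => fderiv ℝ φ x (X j x))

/-- The standing geometric assumptions on the vector fields: they are locally Lipschitz on `ℝ^N`;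
in the open set `U` the control distance `d_X` is finite and topologically equivalent to the
Euclidean distance; Lebesgue measure is doubling, with homogeneous dimension `Q`, and a
`(1,1)`-Poincaré inequality holds, on all `d_X`-balls centred in `Ω`.

In the Poincaré inequality only restrictions of functions in `C¹_c(ℝ^N)` are tested; as a
hypothesis this asks for at most what the inequality for all `C¹` functions on the closed ball
asks for. -/
structure GeometricAssumptions (U Ω : Set (EuclideanSpace ℝ (Fin N)))
    (X : Fin m → EuclideanSpace ℝ (Fin N) → EuclideanSpace ℝ (Fin N)) (Q : ℝ) : Prop where
  locLip : ∀ j, LocallyLipschitz (X j)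
  connected : ∀ x ∈ U, ∀ y ∈ U, ccDist U X x y < ⊤
  topology : ∀ x ∈ U, Tendsto (fun y => ccDist U X x y) (𝓝 x) (𝓝 0)
  doubling : ∀ x ∈ Ω, ∀ r : ℝ, 0 < r →
    0 < volume (ccBall U X x (2 * r)) ∧
      volume (ccBall U X x (2 * r)) ≤ ENNReal.ofReal (2 ^ Q) * volume (ccBall U X x r)
  poincare : ∃ CP : ℝ, 0 < CP ∧ ∃ ν : ℝ, 0 < ν ∧ ∀ x ∈ Ω, ∀ r : ℝ, 0 < r →
    ∀ u : EuclideanSpace ℝ (Fin N) → ℝ, ContDiff ℝ 1 u → HasCompactSupport u →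
      ⨍ y in ccBall U X x r, |u y - ⨍ z in ccBall U X x r, u z|
        ≤ CP * r * ⨍ y in ccBall U X x (ν * r), ‖xGrad X u y‖

/-! ### The spaces `W₀^{1,q}(Ω, X)` and weak solutions -/

/-- `u ∈ W₀^{1,q}(Ω, X)` with `X`-gradient `g = Xu`: there are `φ_n ∈ C_c^∞(Ω)` with
`φ_n → u` and `Xφ_n → g` in `L^q(Ω)`. -/
structure MemW0 (Ω : Set (EuclideanSpace ℝ (Fin N)))
    (X : Fin m → EuclideanSpace ℝ (Fin N) → EuclideanSpace ℝ (Fin N)) (q : ℝ≥0∞)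
    (u : EuclideanSpace ℝ (Fin N) → ℝ)
    (g : EuclideanSpace ℝ (Fin N) → EuclideanSpace ℝ (Fin m)) : Prop where
  memLp_fun : MemLp u q (volume.restrict Ω)
  memLp_grad : MemLp g q (volume.restrict Ω)
  approx : ∃ φ : ℕ → EuclideanSpace ℝ (Fin N) → ℝ,
    (∀ n, ContDiff ℝ ((⊤ : ℕ∞) : WithTop ℕ∞) (φ n) ∧ HasCompactSupport (φ n) ∧
      tsupport (φ n) ⊆ Ω) ∧
    Tendsto (fun n => eLpNorm (fun x => φ n x - u x) q (volume.restrict Ω)) atTop (𝓝 0) ∧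
    Tendsto (fun n => eLpNorm (fun x => xGrad X (φ n) x - g x) q (volume.restrict Ω))
      atTop (𝓝 0)

/-- `A` is a bounded measurable `m × m` matrix field on `Ω` with
`α |η|² ≤ A(x)η · η ≤ β |η|²` for all `η ∈ ℝ^m`. Boundedness of the entries follows from these
inequalities when `A` is symmetric; symmetry is not required. -/
structure IsElliptic (Ω : Set (EuclideanSpace ℝ (Fin N))) (α β : ℝ)
    (A : EuclideanSpace ℝ (Fin N) → Matrix (Fin m) (Fin m) ℝ) : Prop where
  measurable : ∀ i j, AEMeasurable (fun x => A x i j) (volume.restrict Ω)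
  elliptic : ∀ᵐ x ∂(volume.restrict Ω), ∀ η : EuclideanSpace ℝ (Fin m),
    α * ‖η‖ ^ 2 ≤ (A x).mulVec η.ofLp ⬝ᵥ η.ofLp ∧ (A x).mulVec η.ofLp ⬝ᵥ η.ofLp ≤ β * ‖η‖ ^ 2
  bounded : ∃ M : ℝ, ∀ᵐ x ∂(volume.restrict Ω), ∀ i j, |A x i j| ≤ M

/-- `u ∈ W₀^{1,2}(Ω, X)`, with `Xu = g`, is the weak solution of `X^*(A Xu) = f` in `Ω`, `u = 0`
on `∂Ω`: `∫ A Xu · Xv = ∫ f v` for every `v ∈ W₀^{1,2}(Ω, X)` (here `h = Xv`). -/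
def IsWeakSolution (Ω : Set (EuclideanSpace ℝ (Fin N)))
    (X : Fin m → EuclideanSpace ℝ (Fin N) → EuclideanSpace ℝ (Fin N))
    (A : EuclideanSpace ℝ (Fin N) → Matrix (Fin m) (Fin m) ℝ)
    (f u : EuclideanSpace ℝ (Fin N) → ℝ)
    (g : EuclideanSpace ℝ (Fin N) → EuclideanSpace ℝ (Fin m)) : Prop :=
  MemW0 Ω X 2 u g ∧
    ∀ (v : EuclideanSpace ℝ (Fin N) → ℝ) (h : EuclideanSpace ℝ (Fin N) → EuclideanSpace ℝ (Fin m)),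
      MemW0 Ω X 2 v h →
        ∫ x in Ω, (A x).mulVec (g x).ofLp ⬝ᵥ (h x).ofLp = ∫ x in Ω, f x * v x

/-- The truncation `T_k` at height `k`. -/
def trunc (k s : ℝ) : ℝ := max (-k) (min s k)

/-- `u` is a solution found by approximation of `X^*(A Xu) = f` in `Ω`, `u = 0` on `∂Ω`:
if `u_n` are the weak solutions with data `T_n(f)`, then along a subsequence `u_n → u` strongly
in `L^s(Ω)` for all `1 ≤ s < Q/(Q-2)`, and weakly in `W₀^{1,q}(Ω, X)` for all
`1 ≤ q < Q/(Q-1)`. -/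
def IsSolutionByApproximation (Ω : Set (EuclideanSpace ℝ (Fin N)))
    (X : Fin m → EuclideanSpace ℝ (Fin N) → EuclideanSpace ℝ (Fin N)) (Q : ℝ)
    (A : EuclideanSpace ℝ (Fin N) → Matrix (Fin m) (Fin m) ℝ)
    (f u : EuclideanSpace ℝ (Fin N) → ℝ) : Prop :=
  ∃ (un : ℕ → EuclideanSpace ℝ (Fin N) → ℝ)
    (gn : ℕ → EuclideanSpace ℝ (Fin N) → EuclideanSpace ℝ (Fin m))
    (g : EuclideanSpace ℝ (Fin N) → EuclideanSpace ℝ (Fin m)) (ψ : ℕ → ℕ),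
    (∀ n : ℕ, IsWeakSolution Ω X A (fun x => trunc (n : ℝ) (f x)) (un n) (gn n)) ∧
    StrictMono ψ ∧
    (∀ s : ℝ, 1 ≤ s → s < Q / (Q - 2) →
      Tendsto (fun n => eLpNorm (fun x => un (ψ n) x - u x) (ENNReal.ofReal s)
        (volume.restrict Ω)) atTop (𝓝 0)) ∧
    (∀ q : ℝ, 1 ≤ q → q < Q / (Q - 1) →
      MemW0 Ω X (ENNReal.ofReal q) u g ∧
      ∀ q' : ℝ≥0∞, (ENNReal.ofReal q).HolderConjugate q' →
        ∀ h : EuclideanSpace ℝ (Fin N) → EuclideanSpace ℝ (Fin m),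
          MemLp h q' (volume.restrict Ω) →
          Tendsto (fun n => ∫ x in Ω, inner ℝ (gn (ψ n) x) (h x)) atTop
            (𝓝 (∫ x in Ω, inner ℝ (g x) (h x))))

end XElliptic

end

namespace XElliptic

/-! ### Subunit paths, control balls and the doubling property. -/

section Geometry

variable {N m : ℕ} {U Ω : Set (EuclideanSpace ℝ (Fin N))}
  {X : Fin m → EuclideanSpace ℝ (Fin N) → EuclideanSpace ℝ (Fin N)} {Q : ℝ}

/-! The equation is linear, so the theorem reduces to a priori bounds for weak solutions whose
constants do not see `A`: applied to differences of approximate solutions, they make the whole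
sequence Cauchy.

The bounds come from testing with a power. Formally, the test function `|u|^(2γ-2) u` with `1/2 < γ
< 1` gives `α (2γ-1) ∫ |u|^(2γ-2) |Xu|² ≤ ∫ |f| |u|^(2γ-1)`. The Sobolev inequality for `|u|^(γ-1)
u` bounds the left side below by a multiple of the `2γ`-th power of the norm of `u` in `L^(2*γ)`,
where `2* = 2Q/(Q-2)`; Hölder bounds the right side by `‖f‖_p` times the `(2γ-1)`-th power of the
norm of `u` in `L^(p'(2γ-1))`. The choice `γ = p(Q-2)/(2(Q-2p))` makes both exponents equal to
`p**`, and division leaves a bound linear in `f` (`IsWeakSolution.mul_eLpNorm_le`). The conditions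
`p > 1` and `p < 2Q/(Q+2)` say exactly that `γ > 1/2` and `γ < 1`. The weighted energy and Hölder
also control `Xu` in `L^(p*)`, `p* = pQ/(Q-p)` (`IsWeakSolution.eLpNorm_grad_le`). Powers are
regularized by `regPow` to stay smooth at `0`.

Hence `u_n` converges in `L^(p**)` and `Xu_n` in `L^(p*)`, both strongly. Since `p > 1`, these
exponents exceed `Q/(Q-2)` and `Q/(Q-1)`, so the limit is a solution found by approximation. It is
the only one: the linear bound with zero datum determines each `u_n`, and every subsequence has the
same limit.

The Sobolev inequality (`GeometricAssumptions.sobolev_contDiff`) is derived from doubling and the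
Poincaré inequality. Telescoping means over shrinking control balls bounds `|φ(x)|` by a dyadic sum
of averages of `|Xφ|`; the starting mean is controlled because a large ball meets a region of `U`
where `φ` vanishes. Hedberg's splitting and the weak `(1,1)` maximal inequality, interpolated to
`L²`, conclude. Existence of `u_n` is Lax-Milgram on the closed graph of `X` in `L² × L²`. -/

theorem _root_.AbsolutelyContinuousOnInterval.inner_left {E : Type*} [NormedAddCommGroup E]
    [InnerProductSpace ℝ E] {γ : ℝ → E} {a b : ℝ} (h : AbsolutelyContinuousOnInterval γ a b)
    (w : E) : AbsolutelyContinuousOnInterval (fun t => inner ℝ w (γ t)) a b := by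
  refine squeeze_zero (fun t ↦ Finset.sum_nonneg fun i _ ↦ dist_nonneg) (fun t ↦ ?_)
    (by simpa using Filter.Tendsto.const_mul ‖w‖ h)
  rw [Finset.mul_sum]
  refine Finset.sum_le_sum fun i _ ↦ ?_
  rw [dist_eq_norm, dist_eq_norm, ← inner_sub_right]
  exact norm_inner_le_norm _ _

/-- Pairing `γ` with the fixed vector `w = γ b - γ a` reduces the bound to the scalar fundamental
theorem of calculus: `‖w‖² = ∫ ⟨w, γ'⟩ ≤ ‖w‖ L (b - a)`. -/
theorem _root_.AbsolutelyContinuousOnInterval.norm_sub_le {E : Type*} [NormedAddCommGroup E]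
    [InnerProductSpace ℝ E] {γ : ℝ → E} {a b L : ℝ} (hab : a ≤ b)
    (h : AbsolutelyContinuousOnInterval γ a b)
    (hd : ∀ᵐ t, t ∈ Set.Icc a b → ∃ v, ‖v‖ ≤ L ∧ HasDerivAt γ v t) :
    ‖γ b - γ a‖ ≤ L * (b - a) := by
  set w := γ b - γ a with hw
  have hf := h.inner_left w
  have h1 := hf.integral_deriv_eq_sub
  have h2 : ∫ t in a..b, deriv (fun t => inner ℝ w (γ t)) t ≤ ∫ _ in a..b, ‖w‖ * L := by
    refine intervalIntegral.integral_mono_ae_restrict hab hf.intervalIntegrable_deriv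
      intervalIntegrable_const ?_
    refine (ae_restrict_iff' measurableSet_Icc).2 ?_
    filter_upwards [hd] with t ht hmem
    obtain ⟨v, hv, hder⟩ := ht hmem
    have : HasDerivAt (fun t => inner ℝ w (γ t)) (inner ℝ w v) t := by
      simpa using (hasDerivAt_const t w).inner ℝ hder
    rw [this.deriv]
    exact (real_inner_le_norm w v).trans (mul_le_mul_of_nonneg_left hv (norm_nonneg _))
  rw [h1, ← inner_sub_right, ← hw, real_inner_self_eq_norm_sq, intervalIntegral.integral_const,
    smul_eq_mul] at h2
  -- When `w = 0` the claim is `0 ≤ L (b - a)`; the sign of `L` has to be read off at a point where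
  -- the derivative bound holds.
  by_cases h0 : ‖w‖ = 0
  · rw [h0]
    rcases hab.eq_or_lt with h3 | h3
    · simp [h3]
    · have hne : ∃ t ∈ Set.Icc a b, ∃ v, ‖v‖ ≤ L ∧ HasDerivAt γ v t := by
        by_contra hcon
        have : volume (Set.Icc a b) = 0 := by
          refine measure_mono_null (fun t ht => ?_) hd
          exact fun h => hcon ⟨t, ht, h ht⟩
        simp at this
        linarith
      obtain ⟨t, _, v, hv, _⟩ := hne
      exact mul_nonneg ((norm_nonneg v).trans hv) (sub_nonneg.2 hab)
  · have h4 : 0 < ‖w‖ := lt_of_le_of_ne (norm_nonneg _) (Ne.symm h0)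
    nlinarith

theorem norm_sum_smul_le_of_sum_sq_le_one {E : Type*} [NormedAddCommGroup E] [NormedSpace ℝ E]
    {θ : Fin m → ℝ} (hθ : ∑ j, θ j ^ 2 ≤ 1) {Y : Fin m → E} {M : ℝ} (hY : ∀ j, ‖Y j‖ ≤ M) :
    ‖∑ j, θ j • Y j‖ ≤ m * M := by
  have h1 : ∀ j, ‖θ j • Y j‖ ≤ M := fun j => by
    have h2 : θ j ^ 2 ≤ 1 :=
      (Finset.single_le_sum (f := fun j => θ j ^ 2) (fun i _ => sq_nonneg _)
        (Finset.mem_univ j)).trans hθ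
    have h3 : |θ j| ≤ 1 := by rwa [sq_le_one_iff_abs_le_one] at h2
    rw [norm_smul, Real.norm_eq_abs]
    calc |θ j| * ‖Y j‖ ≤ 1 * ‖Y j‖ := by gcongr
      _ ≤ M := by simpa using hY j
  refine (norm_sum_le_of_le _ fun j _ => h1 j).trans ?_
  simp

theorem IsSubunit.norm_sub_le {T : ℝ} {γ : ℝ → EuclideanSpace ℝ (Fin N)}
    (h : IsSubunit U X T γ) {s t M : ℝ} (hs : 0 ≤ s) (hst : s ≤ t) (ht : t ≤ T)
    (hM : ∀ τ ∈ Set.Icc s t, ∀ j, ‖X j (γ τ)‖ ≤ M) : ‖γ t - γ s‖ ≤ m * M * (t - s) := by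
  have hsub : Set.Icc s t ⊆ Set.Icc 0 T := Set.Icc_subset_Icc hs ht
  refine AbsolutelyContinuousOnInterval.norm_sub_le hst (h.absCont.mono ?_) ?_
  · rwa [Set.uIcc_of_le hst, Set.uIcc_of_le (hs.trans (hst.trans ht))]
  · filter_upwards [(ae_restrict_iff' measurableSet_Icc).1 h.subunit] with τ hτ hmem
    obtain ⟨θ, hθ, hd⟩ := hτ (hsub hmem)
    exact ⟨_, norm_sum_smul_le_of_sum_sq_le_one hθ (hM τ hmem), hd⟩

/-- The fields are bounded on the compact image of the path. The Lipschitz bound gives absolute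
continuity of reversed and concatenated paths. -/
theorem IsSubunit.exists_lipschitzOnWith (hX : ∀ j, Continuous (X j)) {T : ℝ} (hT : 0 ≤ T)
    {γ : ℝ → EuclideanSpace ℝ (Fin N)} (h : IsSubunit U X T γ) :
    ∃ K, LipschitzOnWith K γ (Set.Icc 0 T) := by
  have hc : ContinuousOn γ (Set.Icc 0 T) := by
    simpa [Set.uIcc_of_le hT] using h.absCont.continuousOn
  have hb : ∀ j, ∃ C, ∀ τ ∈ Set.Icc 0 T, ‖X j (γ τ)‖ ≤ C := fun j =>
    isCompact_Icc.exists_bound_of_continuousOn ((hX j).comp_continuousOn hc)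
  choose C hC using hb
  have hM : ∀ τ ∈ Set.Icc 0 T, ∀ j, ‖X j (γ τ)‖ ≤ ∑ i, |C i| := fun τ hτ j =>
    ((hC j τ hτ).trans (le_abs_self _)).trans
      (Finset.single_le_sum (f := fun i => |C i|) (fun i _ => abs_nonneg _) (Finset.mem_univ j))
  refine ⟨(m * ∑ i, |C i|).toNNReal, LipschitzOnWith.of_dist_le_mul fun s hs t ht => ?_⟩
  rw [Real.coe_toNNReal _ (by positivity)]
  wlog hst : s ≤ t generalizing s t
  · rw [dist_comm, dist_comm s t]
    exact this t ht s hs (le_of_not_ge hst)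
  rw [dist_comm, dist_comm s, dist_eq_norm, Real.dist_eq, abs_of_nonneg (sub_nonneg.2 hst)]
  exact h.norm_sub_le hs.1 hst ht.2 fun τ hτ j =>
    hM τ ⟨hs.1.trans hτ.1, hτ.2.trans ht.2⟩ j

theorem mem_ccBall_iff {x y : EuclideanSpace ℝ (Fin N)} {r : ℝ} :
    y ∈ ccBall U X x r ↔ ∃ T : ℝ, 0 < T ∧ T < r ∧
      ∃ γ : ℝ → EuclideanSpace ℝ (Fin N), IsSubunit U X T γ ∧ γ 0 = x ∧ γ T = y := by
  simp only [ccBall, ccDist, Set.mem_ofPred_eq, sInf_lt_iff]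
  constructor
  · rintro ⟨τ, ⟨T, hT, rfl, hγ⟩, hlt⟩
    exact ⟨T, hT, (ENNReal.ofReal_lt_ofReal_iff_of_nonneg hT.le).1 hlt, hγ⟩
  · rintro ⟨T, hT, hTr, hγ⟩
    exact ⟨_, ⟨T, hT, rfl, hγ⟩, (ENNReal.ofReal_lt_ofReal_iff_of_nonneg hT.le).2 hTr⟩

theorem ccBall_mono {x : EuclideanSpace ℝ (Fin N)} {r s : ℝ} (h : r ≤ s) :
    ccBall U X x r ⊆ ccBall U X x s := fun _ hy =>
  lt_of_lt_of_le hy (ENNReal.ofReal_le_ofReal h)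

theorem ccBall_subset (x : EuclideanSpace ℝ (Fin N)) (r : ℝ) : ccBall U X x r ⊆ U := by
  intro y hy
  obtain ⟨T, hT, -, γ, hγ, -, rfl⟩ := mem_ccBall_iff.1 hy
  exact hγ.mem T ⟨hT.le, le_rfl⟩

theorem IsSubunit.reverse (hX : ∀ j, Continuous (X j)) {T : ℝ} (hT : 0 ≤ T)
    {γ : ℝ → EuclideanSpace ℝ (Fin N)} (h : IsSubunit U X T γ) :
    IsSubunit U X T (fun t => γ (T - t)) := by
  have hmaps : ∀ t, T - t ∈ Set.Icc 0 T ↔ t ∈ Set.Icc 0 T := fun t => by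
    simp only [Set.mem_Icc]; constructor <;> rintro ⟨h1, h2⟩ <;> constructor <;> linarith
  refine ⟨fun t ht => h.mem _ ((hmaps t).2 ht), ?_, ?_⟩
  · obtain ⟨K, hK⟩ := h.exists_lipschitzOnWith hX hT
    refine LipschitzOnWith.absolutelyContinuousOnInterval (K := K) ?_
    rw [Set.uIcc_of_le hT]
    refine LipschitzOnWith.of_dist_le_mul fun s hs t ht => ?_
    have := hK.dist_le_mul _ ((hmaps s).2 hs) _ ((hmaps t).2 ht)
    rwa [Real.dist_eq, sub_sub_sub_cancel_left, ← Real.dist_eq, dist_comm t s] at this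
  · have h1 := (ae_restrict_iff' measurableSet_Icc).1 h.subunit
    have h2 := (Measure.measurePreserving_sub_left (volume : Measure ℝ) T).quasiMeasurePreserving.ae h1
    refine (ae_restrict_iff' measurableSet_Icc).2 ?_
    filter_upwards [h2] with t ht hmem
    obtain ⟨θ, hθ, hd⟩ := ht ((hmaps t).2 hmem)
    refine ⟨fun j => -θ j, by simpa using hθ, ?_⟩
    have := HasDerivAt.scomp t hd ((hasDerivAt_id t).const_sub T)
    simpa [Function.comp_def] using this

theorem mem_ccBall_comm (hX : ∀ j, Continuous (X j)) {x y : EuclideanSpace ℝ (Fin N)} {r : ℝ}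
    (h : y ∈ ccBall U X x r) : x ∈ ccBall U X y r := by
  obtain ⟨T, hT, hTr, γ, hγ, h0, h1⟩ := mem_ccBall_iff.1 h
  exact mem_ccBall_iff.2 ⟨T, hT, hTr, _, hγ.reverse hX hT.le, by simpa using h1, by simpa using h0⟩

theorem IsSubunit.concat (hX : ∀ j, Continuous (X j)) {S T : ℝ} (hS : 0 ≤ S) (hT : 0 ≤ T)
    {γ δ : ℝ → EuclideanSpace ℝ (Fin N)} (hγ : IsSubunit U X S γ) (hδ : IsSubunit U X T δ)
    (heq : γ S = δ 0) :
    IsSubunit U X (S + T) (fun t => if t ≤ S then γ t else δ (t - S)) := by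
  refine ⟨fun t ht => ?_, ?_, ?_⟩
  · split_ifs with h
    · exact hγ.mem t ⟨ht.1, h⟩
    · exact hδ.mem _ ⟨by linarith, by linarith [ht.2]⟩
  · obtain ⟨K, hK⟩ := hγ.exists_lipschitzOnWith hX hS
    obtain ⟨L, hL⟩ := hδ.exists_lipschitzOnWith hX hT
    refine LipschitzOnWith.absolutelyContinuousOnInterval (K := max K L) ?_
    rw [Set.uIcc_of_le (add_nonneg hS hT)]
    refine LipschitzOnWith.of_dist_le_mul fun s hs t ht => ?_
    wlog hst : s ≤ t generalizing s t
    · rw [dist_comm, dist_comm s t]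
      exact this t ht s hs (le_of_not_ge hst)
    have hKM : (K : ℝ) ≤ (max K L : ℝ≥0) := by exact_mod_cast le_max_left K L
    have hLM : (L : ℝ) ≤ (max K L : ℝ≥0) := by exact_mod_cast le_max_right K L
    rw [Real.dist_eq s t, abs_sub_comm, abs_of_nonneg (sub_nonneg.2 hst)]
    have hKd : ∀ a ∈ Set.Icc 0 S, ∀ b ∈ Set.Icc 0 S, a ≤ b →
        dist (γ a) (γ b) ≤ (max K L : ℝ≥0) * (b - a) := fun a ha b hb hab => by
      have := hK.dist_le_mul a ha b hb
      rw [Real.dist_eq a b, abs_sub_comm, abs_of_nonneg (sub_nonneg.2 hab)] at this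
      exact this.trans (mul_le_mul_of_nonneg_right hKM (sub_nonneg.2 hab))
    have hLd : ∀ a ∈ Set.Icc 0 T, ∀ b ∈ Set.Icc 0 T, a ≤ b →
        dist (δ a) (δ b) ≤ (max K L : ℝ≥0) * (b - a) := fun a ha b hb hab => by
      have := hL.dist_le_mul a ha b hb
      rw [Real.dist_eq a b, abs_sub_comm, abs_of_nonneg (sub_nonneg.2 hab)] at this
      exact this.trans (mul_le_mul_of_nonneg_right hLM (sub_nonneg.2 hab))
    split_ifs with h1 h2 h2
    · exact hKd s ⟨hs.1, h1⟩ t ⟨ht.1, h2⟩ hst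
    · push Not at h2
      have e1 := hKd s ⟨hs.1, h1⟩ S ⟨hS, le_rfl⟩ h1
      have e2 := hLd 0 ⟨le_rfl, hT⟩ (t - S) ⟨by linarith, by linarith [ht.2]⟩ (by linarith)
      have e3 := dist_triangle (γ s) (γ S) (δ (t - S))
      rw [heq] at e1 e3
      linarith
    · exact absurd (hst.trans h2) h1
    · have := hLd (s - S) ⟨by linarith, by linarith [hs.2]⟩ (t - S)
        ⟨by linarith, by linarith [ht.2]⟩ (by linarith)
      simpa using this
  · have h1 := (ae_restrict_iff' measurableSet_Icc).1 hγ.subunit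
    have h2 := (measurePreserving_sub_right (volume : Measure ℝ) S).quasiMeasurePreserving.ae
      ((ae_restrict_iff' measurableSet_Icc).1 hδ.subunit)
    refine (ae_restrict_iff' measurableSet_Icc).2 ?_
    -- The concatenated path need not be differentiable at the junction, which is a null set.
    have h3 : ∀ᵐ t : ℝ, t ≠ S := by simp [ae_iff]
    filter_upwards [h1, h2, h3] with t ht1 ht2 hne hmem
    rcases lt_or_gt_of_ne hne with hlt | hgt
    · obtain ⟨θ, hθ, hd⟩ := ht1 ⟨hmem.1, hlt.le⟩
      refine ⟨θ, hθ, ?_⟩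
      simp only [if_pos hlt.le]
      refine hd.congr_of_eventuallyEq ?_
      filter_upwards [Iio_mem_nhds hlt] with s hs
      exact if_pos (le_of_lt hs)
    · obtain ⟨θ, hθ, hd⟩ := ht2 ⟨by linarith, by linarith [hmem.2]⟩
      refine ⟨θ, hθ, ?_⟩
      simp only [if_neg (not_le.2 hgt)]
      have := HasDerivAt.scomp t hd ((hasDerivAt_id t).sub_const S)
      rw [one_smul] at this
      refine this.congr_of_eventuallyEq ?_
      filter_upwards [Ioi_mem_nhds hgt] with s hs
      have hs' : ¬ s ≤ S := not_le.2 hs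
      simp [hs']

theorem mem_ccBall_trans (hX : ∀ j, Continuous (X j)) {x y z : EuclideanSpace ℝ (Fin N)} {r s : ℝ}
    (hy : y ∈ ccBall U X x r) (hz : z ∈ ccBall U X y s) : z ∈ ccBall U X x (r + s) := by
  obtain ⟨S, hS, hSr, γ, hγ, h0, h1⟩ := mem_ccBall_iff.1 hy
  obtain ⟨T, hT, hTs, δ, hδ, h2, h3⟩ := mem_ccBall_iff.1 hz
  refine mem_ccBall_iff.2 ⟨S + T, by linarith, by linarith, _,
    hγ.concat hX hS.le hT.le hδ (h1.trans h2.symm), ?_, ?_⟩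
  · simp [hS.le, h0]
  · simp [hT, h3]

theorem GeometricAssumptions.continuous (hX : GeometricAssumptions U Ω X Q) (j : Fin m) :
    Continuous (X j) := (hX.locLip j).continuous

theorem GeometricAssumptions.isOpen_ccBall (hX : GeometricAssumptions U Ω X Q)
    (x : EuclideanSpace ℝ (Fin N)) (r : ℝ) : IsOpen (ccBall U X x r) := by
  rw [isOpen_iff_mem_nhds]
  intro y hy
  have hyU := ccBall_subset x r hy
  obtain ⟨T, hT, hTr, γ, hγ⟩ := mem_ccBall_iff.1 hy
  -- The slack `r - T` is shared equally: half keeps `y` in a smaller ball, half is left for the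
  -- points near `y`.
  have hy' : y ∈ ccBall U X x ((T + r) / 2) :=
    mem_ccBall_iff.2 ⟨T, hT, by linarith, γ, hγ⟩
  have hpos : (0 : ℝ≥0∞) < ENNReal.ofReal ((r - T) / 2) := ENNReal.ofReal_pos.2 (by linarith)
  filter_upwards [(hX.topology y hyU).eventually (gt_mem_nhds hpos)] with z hz
  have := mem_ccBall_trans hX.continuous hy' (s := (r - T) / 2) hz
  rwa [show (T + r) / 2 + (r - T) / 2 = r by ring] at this

theorem GeometricAssumptions.mem_ccBall_self (hX : GeometricAssumptions U Ω X Q)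
    {x : EuclideanSpace ℝ (Fin N)} (hx : x ∈ U) {r : ℝ} (hr : 0 < r) : x ∈ ccBall U X x r := by
  have := (hX.topology x hx).eventually (gt_mem_nhds (ENNReal.ofReal_pos.2 hr))
  exact this.self_of_nhds

/-- Until its first exit from the Euclidean ball a subunit path has speed at most `m M`, with `M` a
bound for the fields there, so leaving takes time at least of order `ε / (m M)`. The `+ 1` in the
radius keeps the denominator positive. -/
theorem exists_ccBall_subset_ball (hX : ∀ j, Continuous (X j)) (x : EuclideanSpace ℝ (Fin N))
    {ε : ℝ} (hε : 0 < ε) : ∃ r, 0 < r ∧ ccBall U X x r ⊆ Metric.ball x ε := by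
  have hb : ∀ j, ∃ C, ∀ y ∈ Metric.closedBall x ε, ‖X j y‖ ≤ C := fun j =>
    (isCompact_closedBall x ε).exists_bound_of_continuousOn (hX j).continuousOn
  choose C hC using hb
  set M := ∑ i, |C i| with hMdef
  have hM0 : 0 ≤ M := Finset.sum_nonneg fun _ _ => abs_nonneg _
  have hM : ∀ y ∈ Metric.closedBall x ε, ∀ j, ‖X j y‖ ≤ M := fun y hy j =>
    ((hC j y hy).trans (le_abs_self _)).trans
      (Finset.single_le_sum (f := fun i => |C i|) (fun i _ => abs_nonneg _) (Finset.mem_univ j))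
  have hL : 0 < m * M + 1 := by positivity
  refine ⟨ε / (m * M + 1), by positivity, fun y hy => ?_⟩
  obtain ⟨T, hT, hTr, γ, hγ, rfl, rfl⟩ := mem_ccBall_iff.1 hy
  rw [lt_div_iff₀ hL] at hTr
  have hc : ContinuousOn γ (Set.Icc 0 T) := by
    simpa [Set.uIcc_of_le hT.le] using hγ.absCont.continuousOn
  by_contra hcon
  have hcon' : ε ≤ dist (γ T) (γ 0) := by simpa using hcon
  set A := Set.Icc 0 T ∩ (fun t => dist (γ t) (γ 0)) ⁻¹' Set.Ici ε with hA
  have hAcl : IsClosed A :=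
    ContinuousOn.preimage_isClosed_of_isClosed (continuous_dist.comp_continuousOn (hc.prodMk continuousOn_const)) isClosed_Icc
      isClosed_Ici
  have hAc : IsCompact A := isCompact_Icc.of_isClosed_subset hAcl Set.inter_subset_left
  obtain ⟨t0, ht0, hmin⟩ := hAc.exists_isLeast ⟨T, ⟨hT.le, le_rfl⟩, hcon'⟩
  have hlt : ∀ s ∈ Set.Ico 0 t0, γ s ∈ Metric.ball (γ 0) ε := fun s hs => by
    by_contra hns
    have : t0 ≤ s := hmin ⟨⟨hs.1, hs.2.le.trans ht0.1.2⟩, by simpa using hns⟩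
    exact absurd hs.2 (not_lt.2 this)
  have ht0pos : 0 < t0 := by
    rcases ht0.1.1.eq_or_lt with h | h
    · have := ht0.2
      simp only [← h, Set.mem_preimage, dist_self, Set.mem_Ici] at this
      linarith
    · exact h
  have hcl : ∀ s ∈ Set.Icc 0 t0, γ s ∈ Metric.closedBall (γ 0) ε := by
    have hcont : ContinuousOn γ (closure (Set.Ico 0 t0)) := by
      rw [closure_Ico ht0pos.ne]
      exact hc.mono (Set.Icc_subset_Icc_right ht0.1.2)
    have h1 : Set.MapsTo γ (Set.Ico 0 t0) (Metric.ball (γ 0) ε) := hlt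
    have h2 := h1.closure_of_continuousOn hcont
    rw [closure_Ico ht0pos.ne] at h2
    exact fun s hs => Metric.closure_ball_subset_closedBall (h2 hs)
  have h3 := hγ.norm_sub_le le_rfl ht0pos.le ht0.1.2 fun τ hτ j => hM _ (hcl τ hτ) j
  have h4 : ε ≤ ‖γ t0 - γ 0‖ := by rw [← dist_eq_norm]; exact ht0.2
  have h5 : (m : ℝ) * M * (t0 - 0) ≤ m * M * T := by
    have := ht0.1.2
    rw [sub_zero]
    gcongr
  nlinarith

theorem GeometricAssumptions.volume_ccBall_pos (hX : GeometricAssumptions U Ω X Q)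
    {x : EuclideanSpace ℝ (Fin N)} (hx : x ∈ Ω) {r : ℝ} (hr : 0 < r) :
    0 < volume (ccBall U X x r) := by
  have := (hX.doubling x hx (r / 2) (by positivity)).1
  rwa [mul_div_cancel₀ _ (two_ne_zero)] at this

/-- Doubling is iterated `n + 1` times with `2^n ≤ R / r < 2^(n+1)`; the factor `2 ^ Q` pays for the
rounding. -/
theorem GeometricAssumptions.volume_ccBall_le (hX : GeometricAssumptions U Ω X Q) (hQ : 0 ≤ Q)
    {x : EuclideanSpace ℝ (Fin N)} (hx : x ∈ Ω) {r R : ℝ} (hr : 0 < r) (hrR : r ≤ R) :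
    volume (ccBall U X x R) ≤ ENNReal.ofReal (2 ^ Q * (R / r) ^ Q) * volume (ccBall U X x r) := by
  have hit : ∀ n : ℕ, volume (ccBall U X x (2 ^ n * r)) ≤
      ENNReal.ofReal ((2 ^ n) ^ Q) * volume (ccBall U X x r) := by
    intro n
    induction n with
    | zero => simp
    | succ n ih =>
      have h1 := (hX.doubling x hx (2 ^ n * r) (by positivity)).2
      rw [show (2 : ℝ) ^ (n + 1) * r = 2 * (2 ^ n * r) by ring]
      refine h1.trans ?_
      refine (mul_le_mul_right ih _).trans_eq ?_
      rw [← mul_assoc, ← ENNReal.ofReal_mul (by positivity), pow_succ',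
        Real.mul_rpow (by positivity) (by positivity)]
  obtain ⟨n, hn1, hn2⟩ := exists_nat_pow_near ((one_le_div hr).2 hrR) (one_lt_two (α := ℝ))
  calc volume (ccBall U X x R) ≤ volume (ccBall U X x (2 ^ (n + 1) * r)) :=
        measure_mono (ccBall_mono ((div_lt_iff₀ hr).1 hn2).le)
    _ ≤ ENNReal.ofReal ((2 ^ (n + 1)) ^ Q) * volume (ccBall U X x r) := hit _
    _ ≤ _ := by
        gcongr
        rw [pow_succ', Real.mul_rpow (by positivity) (by positivity)]
        gcongr

theorem GeometricAssumptions.volume_ccBall_lt_top (hX : GeometricAssumptions U Ω X Q) (hQ : 0 ≤ Q)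
    {x : EuclideanSpace ℝ (Fin N)} (hx : x ∈ Ω) (R : ℝ) :
    volume (ccBall U X x R) < ⊤ := by
  obtain ⟨r, hr, hsub⟩ := exists_ccBall_subset_ball (U := U) hX.continuous x one_pos
  have hfin : volume (ccBall U X x r) < ⊤ := (measure_mono hsub).trans_lt measure_ball_lt_top
  rcases le_total r R with h | h
  · exact (hX.volume_ccBall_le hQ hx hr h).trans_lt (ENNReal.mul_lt_top ENNReal.ofReal_lt_top hfin)
  · exact (measure_mono (ccBall_mono h)).trans_lt hfin

/-- The balls about one point of `K` form an increasing open cover of `K`, so one of them contains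
`K`; the triangle inequality then moves the centre. -/
theorem GeometricAssumptions.exists_subset_ccBall (hX : GeometricAssumptions U Ω X Q)
    {K : Set (EuclideanSpace ℝ (Fin N))} (hK : IsCompact K) (hKU : K ⊆ U) :
    ∃ R, 0 < R ∧ ∀ x ∈ K, K ⊆ ccBall U X x R := by
  rcases K.eq_empty_or_nonempty with rfl | ⟨x₀, hx₀⟩
  · exact ⟨1, one_pos, by simp⟩
  obtain ⟨n, hn⟩ := hK.elim_directed_cover (fun n : ℕ => ccBall U X x₀ n)
    (fun n => hX.isOpen_ccBall x₀ n) (fun y hy => by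
      have h1 := hX.connected x₀ (hKU hx₀) y (hKU hy)
      obtain ⟨n, hn⟩ := ENNReal.exists_nat_gt h1.ne
      exact Set.mem_iUnion.2 ⟨n, by simpa [ccBall] using hn⟩)
    (directed_of_isDirected_le fun i j hij => ccBall_mono (by exact_mod_cast hij))
  refine ⟨n + n + 1, by positivity, fun x hx y hy => ?_⟩
  exact ccBall_mono (by linarith)
    (mem_ccBall_trans hX.continuous (mem_ccBall_comm hX.continuous (hn hx)) (hn hy))

/-- This provides a region of `U` on which test functions of `Ω` vanish. If there were none,
`closure Ω = U` would be open, closed, compact and nonempty, whereas the ambient space is connected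
and not compact. -/
theorem exists_closedBall_subset_diff_closure (hN : 2 ≤ N) (hU : IsOpen U)
    (hΩb : Bornology.IsBounded Ω) (hΩU : closure Ω ⊆ U) (hne : Ω.Nonempty) :
    ∃ z ε, 0 < ε ∧ Metric.closedBall z ε ⊆ U \ closure Ω := by
  have hcomp : IsCompact (closure Ω) := hΩb.isCompact_closure
  have : (U \ closure Ω).Nonempty := by
    by_contra h
    rw [Set.not_nonempty_iff_eq_empty, Set.sdiff_eq_empty] at h
    have heq : U = closure Ω := h.antisymm hΩU
    have hclopen : IsClopen (closure Ω) := ⟨isClosed_closure, heq ▸ hU⟩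
    rcases isClopen_iff.1 hclopen with h0 | h1
    · exact (hne.mono subset_closure).ne_empty h0
    · have : Nonempty (Fin N) := ⟨⟨0, by omega⟩⟩
      rw [h1] at hcomp
      exact noncompact_univ _ hcomp
  obtain ⟨z, hz⟩ := this
  obtain ⟨ε, hε, hsub⟩ := Metric.nhds_basis_closedBall.mem_iff.1
    ((hU.sdiff isClosed_closure).mem_nhds hz)
  exact ⟨z, ε, hε, hsub⟩

end Geometry

end XElliptic

namespace XElliptic

/-! ### Dyadic sums, interpolation and the maximal inequality. -/

section Sobolev

theorem sum_min_geometric_le {κ x : ℝ} (hκ : 0 < κ) (hx : 0 < x) (n : ℕ) :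
    ∑ j ∈ Finset.range n, min (x * (1 / 2) ^ j) ((x * (1 / 2) ^ j) ^ (-κ)) ≤
      3 + 1 / ((2 : ℝ) ^ κ - 1) := by
  have h2 : (1 : ℝ) < 2 ^ κ := Real.one_lt_rpow one_lt_two hκ
  have h2' : (0 : ℝ) < 2 ^ κ - 1 := by linarith
  set c := 1 / ((2 : ℝ) ^ κ - 1) with hc
  have hc0 : 0 < c := by positivity
  have hc1 : c * (2 ^ κ - 1) = 1 := by rw [hc]; field_simp
  -- `G` is a bounded potential whose drop from `y` to `y / 2` dominates the term at `y`, so the sum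
  -- telescopes. The constant `c` normalizes the drop to exactly `y ^ (-κ)` when `y / 2 > 1`; the
  -- `3` covers the step across `1`.
  set G : ℝ → ℝ := fun y => if y ≤ 1 then 2 * y else 3 + c - c * y ^ (-κ) with hG
  have hstep : ∀ y : ℝ, 0 < y → min y (y ^ (-κ)) ≤ G y - G (y * (1 / 2)) := by
    intro y hy
    simp only [hG]
    split_ifs with h1 h3 h3
    · exact (min_le_left _ _).trans (by linarith)
    · linarith
    · have h4 : y ^ (-κ) ≤ 1 := Real.rpow_le_one_of_one_le_of_nonpos (by linarith) (by linarith)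
      have h5 : c * y ^ (-κ) ≤ c := by nlinarith
      exact (min_le_right _ _).trans (by linarith)
    · refine (min_le_right _ _).trans ?_
      have h4 : (y * (1 / 2)) ^ (-κ) = y ^ (-κ) * 2 ^ κ := by
        rw [Real.mul_rpow hy.le (by norm_num), one_div, Real.inv_rpow (by norm_num),
          Real.rpow_neg (x := 2) (by norm_num) κ, inv_inv]
      rw [h4]
      have : c * (y ^ (-κ) * 2 ^ κ) - c * y ^ (-κ) = y ^ (-κ) := by
        calc _ = (c * (2 ^ κ - 1)) * y ^ (-κ) := by ring
          _ = _ := by rw [hc1, one_mul]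
      linarith
  have hG0 : ∀ y : ℝ, 0 < y → 0 ≤ G y := by
    intro y hy
    simp only [hG]
    split_ifs with h1
    · linarith
    · have h4 : y ^ (-κ) ≤ 1 := Real.rpow_le_one_of_one_le_of_nonpos (by linarith) (by linarith)
      nlinarith
  have hGC : ∀ y : ℝ, 0 < y → G y ≤ 3 + c := by
    intro y hy
    simp only [hG]
    split_ifs with h1
    · linarith
    · have h4 : 0 ≤ y ^ (-κ) := Real.rpow_nonneg hy.le _
      nlinarith
  have htel : ∑ j ∈ Finset.range n, min (x * (1 / 2) ^ j) ((x * (1 / 2) ^ j) ^ (-κ)) ≤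
      G x - G (x * (1 / 2) ^ n) := by
    induction n with
    | zero => simp
    | succ n ih =>
      rw [Finset.sum_range_succ]
      have := hstep (x * (1 / 2) ^ n) (by positivity)
      rw [mul_assoc, ← pow_succ] at this
      linarith
  have := hG0 (x * (1 / 2) ^ n) (by positivity)
  linarith [hGC x hx]

/-- Hedberg's inequality for dyadic sums. -/
theorem sum_dyadic_le {Q R s b : ℝ} (hQ : 2 < Q) (hR : 0 < R) (hs : 0 < s) (hb : 0 < b)
    {a : ℕ → ℝ} (has : ∀ j, a j ≤ s) (hab : ∀ j, a j ≤ b * (R * (1 / 2) ^ j) ^ (-(Q / 2)))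
    (n : ℕ) :
    ∑ j ∈ Finset.range n, R * (1 / 2) ^ j * a j ≤
      (3 + 1 / ((2 : ℝ) ^ (Q / 2 - 1) - 1)) * (s ^ (1 - 2 / Q) * b ^ (2 / Q)) := by
  -- `ρ` is the radius at which the two bounds `s` and `b ρ^(-Q/2)` agree. In units of `ρ`, the
  -- terms are at most `F` times the minimum in `sum_min_geometric_le`.
  set ρ := (b / s) ^ (2 / Q) with hρ
  have hρ0 : 0 < ρ := by positivity
  set F := s ^ (1 - 2 / Q) * b ^ (2 / Q) with hF
  have hF0 : 0 < F := by positivity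
  have hF1 : ρ * s = F := by
    rw [hρ, hF, Real.div_rpow hb.le hs.le, Real.rpow_sub hs, Real.rpow_one]
    field_simp
  have hρb : ρ ^ (-(Q / 2)) = s / b := by
    rw [hρ, ← Real.rpow_mul (by positivity), show 2 / Q * -(Q / 2) = -1 by field_simp,
      Real.rpow_neg_one, inv_div]
  have key : ∀ j, R * (1 / 2) ^ j * a j ≤
      F * min (R / ρ * (1 / 2) ^ j) ((R / ρ * (1 / 2) ^ j) ^ (-(Q / 2 - 1))) := by
    intro j
    set r := R * (1 / 2) ^ j with hr
    have hr0 : 0 < r := by positivity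
    rw [show R / ρ * (1 / 2) ^ j = r / ρ by rw [hr]; ring, mul_min_of_nonneg _ _ hF0.le]
    refine le_min ?_ ?_
    · calc r * a j ≤ r * s := mul_le_mul_of_nonneg_left (has j) hr0.le
        _ = F * (r / ρ) := by rw [← hF1]; field_simp
    · calc r * a j ≤ r * (b * r ^ (-(Q / 2))) := mul_le_mul_of_nonneg_left (hab j) hr0.le
        _ = F * (r / ρ) ^ (-(Q / 2 - 1)) := by
          rw [show -(Q / 2 - 1) = -(Q / 2) + 1 by ring, Real.rpow_add (by positivity),
            Real.rpow_one, Real.div_rpow hr0.le hρ0.le, hρb, ← hF1]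
          field_simp
  refine (Finset.sum_le_sum fun j _ => key j).trans ?_
  rw [← Finset.mul_sum, mul_comm]
  exact mul_le_mul_of_nonneg_right
    (sum_min_geometric_le (by linarith) (by positivity) n) hF0.le

/-- Marcinkiewicz interpolation between a weak `(1,1)` bound and the trivial `L^∞` bound. -/
theorem lintegral_sq_le_of_weak_type {α β : Type*} [MeasurableSpace α] [MeasurableSpace β]
    {μ : Measure α} {ν : Measure β} [SFinite ν] {w : α → ℝ} {g : β → ℝ}
    (hw : Measurable w) (hw0 : ∀ x, 0 ≤ w x) (hg : Measurable g)
    (hg0 : ∀ x, 0 ≤ g x) {D : ℝ} (hD : 0 ≤ D)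
    (h : ∀ t, 0 < t → μ {x | t < w x} ≤
      ENNReal.ofReal (D / t) * ∫⁻ y in {y | t / 2 < g y}, ENNReal.ofReal (g y) ∂ν) :
    ∫⁻ x, ENNReal.ofReal (w x ^ 2) ∂μ ≤
      ENNReal.ofReal (4 * D) * ∫⁻ x, ENNReal.ofReal (g x ^ 2) ∂ν := by
  have h1 := lintegral_rpow_eq_lintegral_meas_lt_mul μ (Eventually.of_forall hw0)
    hw.aemeasurable (p := 2) two_pos
  simp only [Real.rpow_two] at h1
  rw [h1]
  have h2 : ∫⁻ t in Set.Ioi (0 : ℝ), μ {x | t < w x} * ENNReal.ofReal (t ^ ((2 : ℝ) - 1)) ≤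
      ∫⁻ t in Set.Ioi (0 : ℝ), ENNReal.ofReal D * ∫⁻ y,
        ({y | t / 2 < g y}.indicator (fun y => ENNReal.ofReal (g y)) y) ∂ν := by
    refine setLIntegral_mono' measurableSet_Ioi fun t ht => ?_
    have ht0 : (0 : ℝ) < t := ht
    rw [lintegral_indicator (measurableSet_lt measurable_const hg)]
    calc _ ≤ (ENNReal.ofReal (D / t) * ∫⁻ y in {y | t / 2 < g y}, ENNReal.ofReal (g y) ∂ν) *
          ENNReal.ofReal (t ^ ((2 : ℝ) - 1)) := mul_le_mul_left (h t ht) _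
      _ = _ := by
        rw [mul_right_comm, ← ENNReal.ofReal_mul (by positivity)]
        norm_num
        rw [div_mul_cancel₀ _ ht0.ne']
  refine (mul_le_mul_right h2 _).trans ?_
  have hmeas : Measurable (fun z : ℝ × β =>
      ({y | z.1 / 2 < g y}.indicator (fun y => ENNReal.ofReal (g y)) z.2)) := by
    have : (fun z : ℝ × β => ({y | z.1 / 2 < g y}.indicator (fun y => ENNReal.ofReal (g y)) z.2))
        = {z : ℝ × β | z.1 / 2 < g z.2}.indicator (fun z => ENNReal.ofReal (g z.2)) := by
      ext z
      simp [Set.indicator_apply]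
    rw [this]
    refine Measurable.indicator (by fun_prop) ?_
    exact measurableSet_lt (by fun_prop) (by fun_prop)
  rw [lintegral_const_mul' _ _ ENNReal.ofReal_ne_top, lintegral_lintegral_swap hmeas.aemeasurable]
  -- After Tonelli, a fixed `y` contributes for `0 < t < 2 g y` only. Together with the factor `2`
  -- of the layer-cake formula this gives `4 * D`.
  have h3 : ∀ y, ∫⁻ t in Set.Ioi (0 : ℝ),
      ({y | t / 2 < g y}.indicator (fun y => ENNReal.ofReal (g y)) y) =
        ENNReal.ofReal 2 * ENNReal.ofReal (g y ^ 2) := by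
    intro y
    have : ∀ t, ({y | t / 2 < g y}.indicator (fun y => ENNReal.ofReal (g y)) y) =
        (Set.Iio (2 * g y)).indicator (fun _ => ENNReal.ofReal (g y)) t := by
      intro t
      simp only [Set.indicator_apply, Set.mem_ofPred_eq, Set.mem_Iio, div_lt_iff₀ (two_pos (α := ℝ)),
        mul_comm (g y)]
    simp only [this]
    rw [lintegral_indicator measurableSet_Iio, lintegral_const, Measure.restrict_restrict
      measurableSet_Iio, Measure.restrict_apply_univ, Set.Iio_inter_Ioi, Real.volume_Ioo, sub_zero,
      ← ENNReal.ofReal_mul (hg0 y), ← ENNReal.ofReal_mul two_pos.le]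
    ring_nf
  simp only [h3]
  rw [lintegral_const_mul' _ _ ENNReal.ofReal_ne_top, ← mul_assoc, ← mul_assoc,
    ← ENNReal.ofReal_mul two_pos.le, ← ENNReal.ofReal_mul (by positivity)]
  rw [show 2 * D * 2 = 4 * D by ring]

/-- Enlarging the domain of `|φ - c|` from `S` to `B` costs the ratio of the measures. It compares
means over consecutive balls, and the mean over the largest ball with that over a set where `φ`
vanishes. -/
theorem abs_setAverage_sub_le {α : Type*} [MeasurableSpace α] {μ : Measure α} {S B : Set α}
    (hSB : S ⊆ B) (hS0 : μ S ≠ 0) (hB : μ B ≠ ⊤) {D : ℝ} (hD : μ.real B ≤ D * μ.real S)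
    {φ : α → ℝ} (hφ : IntegrableOn φ B μ) (c : ℝ) :
    |(⨍ y in S, φ y ∂μ) - c| ≤ D * ⨍ y in B, |φ y - c| ∂μ := by
  have hS : μ S ≠ ⊤ := measure_ne_top_of_subset hSB hB
  have hφc : IntegrableOn (fun y => φ y - c) B μ := hφ.sub (integrableOn_const hB)
  have hS0' : 0 < μ.real S := ENNReal.toReal_pos hS0 hS
  have hB0' : 0 < μ.real B := hS0'.trans_le (measureReal_mono hSB hB)
  have h1 : (⨍ y in S, φ y ∂μ) - c = (μ.real S)⁻¹ * ∫ y in S, (φ y - c) ∂μ := by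
    rw [integral_sub (hφ.mono_set hSB) (integrableOn_const hS), setAverage_eq, setIntegral_const,
      smul_eq_mul, smul_eq_mul]
    field_simp
  rw [h1, abs_mul, abs_of_pos (inv_pos.2 hS0'), setAverage_eq, smul_eq_mul]
  have h2 : |∫ y in S, (φ y - c) ∂μ| ≤ ∫ y in B, |φ y - c| ∂μ :=
    (abs_integral_le_integral_abs).trans
      (setIntegral_mono_set hφc.abs (Eventually.of_forall fun _ => abs_nonneg _)
        (LE.le.eventuallyLE hSB))
  have h0 : 0 ≤ ∫ y in B, |φ y - c| ∂μ := integral_nonneg fun _ => abs_nonneg _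
  have h3 : (μ.real S)⁻¹ ≤ D * (μ.real B)⁻¹ := by
    rw [← div_eq_mul_inv, inv_eq_one_div, div_le_div_iff₀ hS0' hB0']
    linarith
  calc _ ≤ (D * (μ.real B)⁻¹) * ∫ y in B, |φ y - c| ∂μ :=
        mul_le_mul h3 h2 (abs_nonneg _) ((inv_pos.2 hS0').le.trans h3)
    _ = _ := by ring

/-- This is nonnegativity of the variance of `g` on `B`. -/
theorem sq_setAverage_mul_le {α : Type*} [MeasurableSpace α] {μ : Measure α} {B : Set α}
    (hB : μ B ≠ ⊤) {g : α → ℝ} (hg : IntegrableOn g B μ)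
    (hg2 : IntegrableOn (fun y => g y ^ 2) B μ) :
    (⨍ y in B, g y ∂μ) ^ 2 * μ.real B ≤ ∫ y in B, g y ^ 2 ∂μ := by
  set a := ⨍ y in B, g y ∂μ with ha
  have h1 : ∫ y in B, g y ∂μ = μ.real B * a := by
    rw [ha]
    exact (measure_smul_setAverage g hB).symm
  have h2 : 0 ≤ ∫ y in B, (g y - a) ^ 2 ∂μ := integral_nonneg fun _ => sq_nonneg _
  have h3 : ∀ y, (g y - a) ^ 2 = g y ^ 2 - 2 * a * g y + a ^ 2 := fun y => by ring
  simp only [h3] at h2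
  have hg3 : IntegrableOn (fun y => 2 * a * g y) B μ := hg.const_mul _
  have hg4 : IntegrableOn (fun y => g y ^ 2 - 2 * a * g y) B μ := hg2.sub hg3
  rw [integral_add hg4 (integrableOn_const hB), integral_sub hg2 hg3, integral_const_mul, h1, setIntegral_const, smul_eq_mul] at h2
  nlinarith

variable {N m : ℕ} {U Ω : Set (EuclideanSpace ℝ (Fin N))}
  {X : Fin m → EuclideanSpace ℝ (Fin N) → EuclideanSpace ℝ (Fin N)} {Q : ℝ}

/-- The weak `(1,1)` inequality for the maximal function of the control balls. -/
theorem GeometricAssumptions.weak_type_maximal (hX : GeometricAssumptions U Ω X Q) (hQ : 0 ≤ Q)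
    (hΩU : closure Ω ⊆ U) {g : EuclideanSpace ℝ (Fin N) → ℝ} (hg : Measurable g)
    (hg0 : ∀ x, 0 ≤ g x) (hgi : Integrable g) {s R : ℝ} (hs : 0 < s) :
    volume {x | x ∈ Ω ∧ ∃ r, 0 < r ∧ r ≤ R ∧ s < ⨍ y in ccBall U X x r, g y} ≤
      ENNReal.ofReal (2 * (2 ^ Q * 4 ^ Q) / s) *
        ∫⁻ y in {y | s / 2 < g y}, ENNReal.ofReal (g y) := by
  set A := {x | x ∈ Ω ∧ ∃ r, 0 < r ∧ r ≤ R ∧ s < ⨍ y in ccBall U X x r, g y} with hA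
  set H := {y | s / 2 < g y} with hH
  have hHm : MeasurableSet H := measurableSet_lt measurable_const hg
  have hex : ∀ x, ∃ r, x ∈ A → 0 < r ∧ r ≤ R ∧ s < ⨍ y in ccBall U X x r, g y := fun x => by
    by_cases hx : x ∈ A
    · exact ⟨hx.2.choose, fun _ => hx.2.choose_spec⟩
    · exact ⟨0, fun h => absurd h hx⟩
  choose r hr using hex
  have hopen : ∀ x r, IsOpen (ccBall U X x r) := hX.isOpen_ccBall
  have hne : ∀ x ∈ A, (ccBall U X x (r x)).Nonempty := fun x hx =>
    ⟨x, hX.mem_ccBall_self (hΩU (subset_closure hx.1)) (hr x hx).1⟩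
  -- Each ball meets a selected one of at least half its radius, so its centre is within three
  -- selected radii of the selected centre. Dilation by `4` therefore suffices to cover `A`.
  obtain ⟨u, huA, hdisj, hcov⟩ := Vitali.exists_disjoint_subfamily_covering_enlargement
    (fun x => ccBall U X x (r x)) A r 2 one_lt_two (fun x hx => (hr x hx).1.le) R
    (fun x hx => (hr x hx).2.1) hne
  have hcount : u.Countable :=
    hdisj.countable_of_isOpen (fun x _ => hopen x _) (fun x hx => hne x (huA hx))
  have hball : ∀ x ∈ A, volume (ccBall U X x (4 * r x)) ≤
      ENNReal.ofReal (2 * (2 ^ Q * 4 ^ Q) / s) *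
        ∫⁻ y in ccBall U X x (r x), H.indicator (fun y => ENNReal.ofReal (g y)) y := by
    intro x hx
    obtain ⟨hr0, -, hlt⟩ := hr x hx
    set B := ccBall U X x (r x) with hB
    have hBm : MeasurableSet B := (hopen x _).measurableSet
    have hBfin : volume B ≠ ⊤ := (hX.volume_ccBall_lt_top hQ hx.1 _).ne
    have hB0 : 0 < volume.real B :=
      ENNReal.toReal_pos (hX.volume_ccBall_pos hx.1 hr0).ne' hBfin
    have h1 : ENNReal.ofReal s * volume B ≤ ∫⁻ y in B, ENNReal.ofReal (g y) := by
      rw [← ofReal_integral_eq_lintegral_ofReal hgi.integrableOn (Eventually.of_forall hg0),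
        ← ENNReal.ofReal_toReal hBfin, ← ENNReal.ofReal_mul hs.le]
      refine ENNReal.ofReal_le_ofReal ?_
      rw [setAverage_eq, smul_eq_mul, ← div_eq_inv_mul, lt_div_iff₀ hB0] at hlt
      exact hlt.le
    -- Values of `g` up to `s / 2` account for at most half of `s |B|`, so the part of `g` above `s
    -- / 2` carries the other half.
    have h2 : ∫⁻ y in B, ENNReal.ofReal (g y) ≤
        (∫⁻ y in B, H.indicator (fun y => ENNReal.ofReal (g y)) y) +
          ENNReal.ofReal (s / 2) * volume B := by
      rw [← setLIntegral_const, ← lintegral_add_right _ measurable_const]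
      refine lintegral_mono fun y => ?_
      by_cases hy : y ∈ H
      · simp [hy]
      · simp only [hy, not_false_eq_true, Set.indicator_of_notMem, zero_add]
        exact ENNReal.ofReal_le_ofReal (not_lt.1 hy)
    have h3 : ENNReal.ofReal (s / 2) * volume B ≤
        ∫⁻ y in B, H.indicator (fun y => ENNReal.ofReal (g y)) y := by
      have h4 := h1.trans h2
      rw [show ENNReal.ofReal s = ENNReal.ofReal (s / 2) + ENNReal.ofReal (s / 2) by
        rw [← ENNReal.ofReal_add (by positivity) (by positivity), add_halves], add_mul] at h4
      exact (ENNReal.add_le_add_iff_right (ENNReal.mul_ne_top ENNReal.ofReal_ne_top hBfin)).1 h4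
    have h4 := hX.volume_ccBall_le hQ hx.1 hr0 (show r x ≤ 4 * r x by linarith)
    rw [mul_div_cancel_right₀ _ hr0.ne'] at h4
    refine h4.trans ?_
    rw [show 2 * ((2 : ℝ) ^ Q * 4 ^ Q) / s = (2 ^ Q * 4 ^ Q) * (s / 2)⁻¹ by field_simp,
      ENNReal.ofReal_mul (p := 2 ^ Q * 4 ^ Q) (by positivity), mul_assoc]
    refine mul_le_mul' le_rfl ?_
    calc volume B = ENNReal.ofReal (s / 2)⁻¹ * (ENNReal.ofReal (s / 2) * volume B) := by
          rw [← mul_assoc, ← ENNReal.ofReal_mul (by positivity),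
            inv_mul_cancel₀ (by positivity), ENNReal.ofReal_one, one_mul]
      _ ≤ _ := mul_le_mul_right h3 _
  have hAsub : A ⊆ ⋃ x ∈ u, ccBall U X x (4 * r x) := by
    intro x hx
    obtain ⟨b, hb, ⟨z, hzx, hzb⟩, hrr⟩ := hcov x hx
    refine Set.mem_iUnion₂.2 ⟨b, hb, ?_⟩
    refine ccBall_mono ?_ (mem_ccBall_trans hX.continuous hzb (mem_ccBall_comm hX.continuous hzx))
    linarith [(hr b (huA hb)).1]
  calc volume A ≤ ∑' x : u, volume (ccBall U X x (4 * r x)) :=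
        (measure_mono hAsub).trans (measure_biUnion_le _ hcount _)
    _ ≤ ∑' x : u, ENNReal.ofReal (2 * (2 ^ Q * 4 ^ Q) / s) *
        ∫⁻ y in ccBall U X x (r x), H.indicator (fun y => ENNReal.ofReal (g y)) y :=
        ENNReal.tsum_le_tsum fun x => hball x (huA x.2)
    _ = ENNReal.ofReal (2 * (2 ^ Q * 4 ^ Q) / s) *
        ∫⁻ y in ⋃ x ∈ u, ccBall U X x (r x), H.indicator (fun y => ENNReal.ofReal (g y)) y := by
        rw [ENNReal.tsum_mul_left, lintegral_biUnion hcount (fun x _ => (hopen x _).measurableSet)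
          hdisj]
    _ ≤ _ := by
        refine mul_le_mul' le_rfl ?_
        rw [← lintegral_indicator hHm]
        exact setLIntegral_le_lintegral _ _

end Sobolev

end XElliptic

namespace XElliptic

/-! ### Pointwise control of a function by its `X`-gradient. -/

section SobolevInequality

variable {N m : ℕ} {U Ω : Set (EuclideanSpace ℝ (Fin N))}
  {X : Fin m → EuclideanSpace ℝ (Fin N) → EuclideanSpace ℝ (Fin N)} {Q : ℝ}

theorem continuous_xGrad (hX : ∀ j, Continuous (X j)) {φ : EuclideanSpace ℝ (Fin N) → ℝ}
    (hφ : ContDiff ℝ 1 φ) : Continuous (xGrad X φ) := by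
  refine (PiLp.continuous_toLp 2 _).comp (continuous_pi fun j => ?_)
  exact (hφ.continuous_fderiv one_ne_zero).clm_apply (hX j)

theorem xGrad_eq_zero_of_notMem_tsupport {φ : EuclideanSpace ℝ (Fin N) → ℝ}
    {x : EuclideanSpace ℝ (Fin N)} (hx : x ∉ tsupport φ) : xGrad X φ x = 0 := by
  have : fderiv ℝ φ x = 0 := by
    by_contra h
    exact hx (support_fderiv_subset ℝ h)
  ext j
  simp [xGrad, this]

theorem hasCompactSupport_xGrad {φ : EuclideanSpace ℝ (Fin N) → ℝ}
    (hφ : HasCompactSupport φ) : HasCompactSupport (xGrad X φ) :=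
  HasCompactSupport.intro hφ fun _ hx => xGrad_eq_zero_of_notMem_tsupport hx

/-- Pointwise bound by a dyadic sum of averages of the gradient over concentric balls. -/
theorem GeometricAssumptions.exists_dyadic_bound (hX : GeometricAssumptions U Ω X Q) (hN : 2 ≤ N)
    (hQ : 0 ≤ Q) (hU : IsOpen U) (hΩ : IsOpen Ω) (hΩb : Bornology.IsBounded Ω)
    (hΩU : closure Ω ⊆ U) (hne : Ω.Nonempty) :
    ∃ R, 0 < R ∧ ∃ ν, 0 < ν ∧ ∃ C, 0 < C ∧ ∃ c, 0 < c ∧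
      (∀ φ : EuclideanSpace ℝ (Fin N) → ℝ, ContDiff ℝ 1 φ → HasCompactSupport φ →
        tsupport φ ⊆ Ω → ∀ x ∈ Ω, ∀ T : ℝ,
        (∀ n, ∑ j ∈ Finset.range n, R * (1 / 2) ^ j *
          ⨍ y in ccBall U X x (ν * (R * (1 / 2) ^ j)), ‖xGrad X φ y‖ ≤ T) → |φ x| ≤ C * T) ∧
      ∀ x ∈ Ω, ∀ j : ℕ, c * (R * (1 / 2) ^ j) ^ Q ≤
        volume.real (ccBall U X x (ν * (R * (1 / 2) ^ j))) := by
  obtain ⟨CP, hCP, ν, hν, hP⟩ := hX.poincare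
  obtain ⟨z, ε, hε, hz⟩ := exists_closedBall_subset_diff_closure hN hU hΩb hΩU hne
  set K := Metric.closedBall z ε with hK
  -- The ball of radius `R` about any point of `Ω` contains both `Ω` and the set `K` outside the
  -- supports.
  obtain ⟨R, hR, hsub⟩ := hX.exists_subset_ccBall
    (hΩb.isCompact_closure.union (isCompact_closedBall z ε))
    (Set.union_subset hΩU (hz.trans Set.sdiff_subset))
  obtain ⟨x₀, hx₀⟩ := hne
  have hmem : ∀ x ∈ Ω, x ∈ closure Ω ∪ K := fun x hx => Or.inl (subset_closure hx)
  have hfin : ∀ x ∈ Ω, ∀ r, volume (ccBall U X x r) ≠ ⊤ := fun x hx r =>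
    (hX.volume_ccBall_lt_top hQ hx r).ne
  have hpos : ∀ x ∈ Ω, ∀ r, 0 < r → volume (ccBall U X x r) ≠ 0 := fun x hx r hr =>
    (hX.volume_ccBall_pos hx hr).ne'
  have hK0 : volume K ≠ 0 := (Metric.measure_closedBall_pos volume z hε).ne'
  have hKr : 0 < volume.real K := ENNReal.toReal_pos hK0 measure_closedBall_lt_top.ne
  set V := volume.real (ccBall U X x₀ (R + R)) with hV
  have hBV : ∀ x ∈ Ω, volume.real (ccBall U X x R) ≤ V := fun x hx =>
    measureReal_mono (fun y hy => mem_ccBall_trans hX.continuous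
      (hsub x₀ (hmem x₀ hx₀) (hmem x hx)) hy) (hfin x₀ hx₀ _)
  have hV0 : 0 ≤ V := measureReal_nonneg
  have hΩ0 : volume Ω ≠ 0 := (hΩ.measure_pos volume ⟨x₀, hx₀⟩).ne'
  have hΩr : 0 < volume.real Ω := ENNReal.toReal_pos hΩ0 hΩb.measure_lt_top.ne
  -- The first summand comes from telescoping the means, the second from the mean over the largest
  -- ball; the lower volume constant comes from doubling between the radii `ν r` and `(1 + ν) R`.
  refine ⟨R, hR, ν, hν, 2 ^ Q * CP + V / volume.real K * CP, by positivity,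
    volume.real Ω / (2 ^ Q * ((1 + ν) / ν) ^ Q * R ^ Q), by positivity, ?_, ?_⟩
  · intro φ hφ hφc hφΩ x hx T hT
    have hφi : Integrable φ := hφ.continuous.integrable_of_hasCompactSupport hφc
    set a : ℕ → ℝ := fun j => ⨍ y in ccBall U X x (ν * (R * (1 / 2) ^ j)), ‖xGrad X φ y‖ with ha
    set A : ℕ → ℝ := fun j => ⨍ y in ccBall U X x (R * (1 / 2) ^ j), φ y with hA
    have hosc : ∀ j, ⨍ y in ccBall U X x (R * (1 / 2) ^ j), |φ y - A j| ≤
        CP * (R * (1 / 2) ^ j) * a j := fun j => hP x hx _ (by positivity) φ hφ hφc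
    have hstep : ∀ j, |A (j + 1) - A j| ≤ 2 ^ Q * CP * (R * (1 / 2) ^ j * a j) := by
      intro j
      have h1 := abs_setAverage_sub_le (μ := volume) (D := 2 ^ Q)
        (S := ccBall U X x (R * (1 / 2) ^ (j + 1)))
        (B := ccBall U X x (R * (1 / 2) ^ j)) (ccBall_mono ?_) (hpos x hx _ (by positivity))
        (hfin x hx _) ?_ hφi.integrableOn (A j)
      · calc _ ≤ 2 ^ Q * (CP * (R * (1 / 2) ^ j) * a j) :=
              h1.trans (mul_le_mul_of_nonneg_left (hosc j) (by positivity))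
          _ = _ := by ring
      · rw [pow_succ]
        have : 0 < R * (1 / 2) ^ j := by positivity
        linarith
      · have h2 := (hX.doubling x hx (R * (1 / 2) ^ (j + 1)) (by positivity)).2
        rw [show 2 * (R * (1 / 2) ^ (j + 1)) = R * (1 / 2) ^ j by rw [pow_succ]; ring] at h2
        have h3 := ENNReal.toReal_mono (ENNReal.mul_ne_top ENNReal.ofReal_ne_top (hfin x hx _)) h2
        rwa [ENNReal.toReal_mul, ENNReal.toReal_ofReal (by positivity)] at h3
    have htel : ∀ n, |A n - A 0| ≤ 2 ^ Q * CP * ∑ j ∈ Finset.range n, R * (1 / 2) ^ j * a j := by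
      intro n
      induction n with
      | zero => simp
      | succ n ih =>
        rw [Finset.sum_range_succ, mul_add]
        calc |A (n + 1) - A 0| = |(A n - A 0) + (A (n + 1) - A n)| := by ring_nf
          _ ≤ _ := (abs_add_le _ _).trans (add_le_add ih (hstep n))
    have hlim : Tendsto A atTop (𝓝 (φ x)) := by
      rw [Metric.tendsto_atTop]
      intro δ hδ
      obtain ⟨η, hη, hball⟩ := Metric.continuous_iff.1 hφ.continuous x (δ / 2) (by positivity)
      obtain ⟨r, hr, hrsub⟩ := exists_ccBall_subset_ball (U := U) hX.continuous x hη
      obtain ⟨n, hn⟩ := exists_pow_lt_of_lt_one (div_pos hr hR) (show (1 / 2 : ℝ) < 1 by norm_num)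
      refine ⟨n, fun k hk => ?_⟩
      have hk' : R * (1 / 2) ^ k ≤ r := by
        have h1 : (1 / 2 : ℝ) ^ k ≤ (1 / 2) ^ n :=
          pow_le_pow_of_le_one (by norm_num) (by norm_num) hk
        rw [lt_div_iff₀ hR] at hn
        nlinarith
      -- A mean of values in a closed convex set lies in that set.
      have hmem : A k ∈ Metric.closedBall (φ x) (δ / 2) := by
        refine (convex_closedBall _ _).set_average_mem Metric.isClosed_closedBall
          (hpos x hx _ (by positivity)) (hfin x hx _) ?_ hφi.integrableOn
        refine (ae_restrict_iff' (hX.isOpen_ccBall x _).measurableSet).2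
          (Eventually.of_forall fun y hy => ?_)
        exact (hball y (hrsub (ccBall_mono hk' hy))).le
      exact lt_of_le_of_lt hmem (by linarith)
    have h1 : |φ x - A 0| ≤ 2 ^ Q * CP * T :=
      le_of_tendsto ((hlim.sub_const (A 0)).abs) (Eventually.of_forall fun n =>
        (htel n).trans (mul_le_mul_of_nonneg_left (hT n) (by positivity)))
    -- `φ` has mean zero over `K`, and `K` lies in the largest ball, so `A 0` is bounded by the
    -- oscillation there, which is the `j = 0` term of the dyadic sum.
    have h2 : |A 0| ≤ V / volume.real K * CP * T := by
      have hKB : K ⊆ ccBall U X x (R * (1 / 2) ^ 0) := by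
        rw [pow_zero, mul_one]
        exact fun y hy => hsub x (hmem x hx) (Or.inr hy)
      have h3 := abs_setAverage_sub_le (μ := volume) (D := V / volume.real K) hKB hK0
        (hfin x hx _) ?_ hφi.integrableOn (A 0)
      · have h4 : ⨍ y in K, φ y = 0 := by
          rw [setAverage_eq, setIntegral_eq_zero_of_forall_eq_zero, smul_zero]
          intro y hy
          by_contra h
          exact (hz hy).2 (subset_closure (hφΩ (subset_tsupport _ h)))
        rw [h4, zero_sub, abs_neg] at h3
        have h5 := hT 1
        rw [Finset.sum_range_one] at h5
        have h6 := hosc 0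
        calc |A 0| ≤ V / volume.real K * (CP * (R * (1 / 2) ^ 0) * a 0) :=
              h3.trans (mul_le_mul_of_nonneg_left h6 (by positivity))
          _ = V / volume.real K * CP * (R * (1 / 2) ^ 0 * a 0) := by ring
          _ ≤ _ := mul_le_mul_of_nonneg_left h5 (by positivity)
      · rw [pow_zero, mul_one, div_mul_cancel₀ _ hKr.ne']
        exact hBV x hx
    calc |φ x| = |(φ x - A 0) + A 0| := by rw [sub_add_cancel]
      _ ≤ 2 ^ Q * CP * T + V / volume.real K * CP * T := (abs_add_le _ _).trans (add_le_add h1 h2)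
      _ = _ := by ring
  · intro x hx j
    set r := R * (1 / 2) ^ j with hr
    have hr0 : 0 < r := by positivity
    have hrR : r ≤ R := by
      have : (1 / 2 : ℝ) ^ j ≤ 1 := pow_le_one₀ (by norm_num) (by norm_num)
      rw [hr]; nlinarith
    -- The outer radius `(1 + ν) * R` exceeds `ν r` and also `R`, whatever the size of `ν`, so this
    -- ball contains `Ω`.
    have h1 := hX.volume_ccBall_le hQ hx (r := ν * r) (R := (1 + ν) * R) (by positivity)
      (by nlinarith)
    have h2 : volume.real Ω ≤ volume.real (ccBall U X x ((1 + ν) * R)) :=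
      measureReal_mono (fun y hy => ccBall_mono (by nlinarith) (hsub x (hmem x hx) (hmem y hy)))
        (hfin x hx _)
    have h3 := ENNReal.toReal_mono (ENNReal.mul_ne_top ENNReal.ofReal_ne_top (hfin x hx _)) h1
    rw [ENNReal.toReal_mul, ENNReal.toReal_ofReal (by positivity)] at h3
    have h4 := h2.trans h3
    have h5 : (1 + ν) * R / (ν * r) = ((1 + ν) / ν) * (R / r) := by field_simp
    rw [h5, Real.mul_rpow (by positivity) (by positivity), Real.div_rpow hR.le hr0.le] at h4
    have hR' : 0 < R ^ Q := by positivity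
    have hr' : 0 < r ^ Q := by positivity
    rw [div_mul_eq_mul_div, div_le_iff₀ (by positivity)]
    change _ ≤ (volume (ccBall U X x (ν * r))).toReal * _
    calc volume.real Ω * r ^ Q ≤ (2 ^ Q * (((1 + ν) / ν) ^ Q * (R ^ Q / r ^ Q)) *
          (volume (ccBall U X x (ν * r))).toReal) * r ^ Q := by gcongr
      _ = _ := by field_simp

end SobolevInequality

end XElliptic

namespace XElliptic

/-! ### The Sobolev inequality. -/

section SobolevInequality

variable {N m : ℕ} {U Ω : Set (EuclideanSpace ℝ (Fin N))}
  {X : Fin m → EuclideanSpace ℝ (Fin N) → EuclideanSpace ℝ (Fin N)} {Q : ℝ}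

/-- The Sobolev inequality for compactly supported `C¹` functions. -/
theorem GeometricAssumptions.sobolev_contDiff (hX : GeometricAssumptions U Ω X Q) (hN : 2 ≤ N)
    (hQ : 2 < Q) (hU : IsOpen U) (hΩ : IsOpen Ω) (hΩb : Bornology.IsBounded Ω)
    (hΩU : closure Ω ⊆ U) :
    ∃ S : ℝ≥0, ∀ φ : EuclideanSpace ℝ (Fin N) → ℝ, ContDiff ℝ 1 φ → HasCompactSupport φ →
      tsupport φ ⊆ Ω →
      eLpNorm φ (ENNReal.ofReal (2 * Q / (Q - 2))) (volume.restrict Ω) ≤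
        S * eLpNorm (xGrad X φ) 2 (volume.restrict Ω) := by
  rcases Ω.eq_empty_or_nonempty with rfl | hne
  · exact ⟨0, fun φ _ _ _ => by simp⟩
  have hQ0 : 0 < Q := by linarith
  have hQ2 : 0 < Q - 2 := by linarith
  obtain ⟨R, hR, ν, hν, C, hC, c, hc, hdy, hvol⟩ :=
    hX.exists_dyadic_bound hN hQ0.le hU hΩ hΩb hΩU hne
  have h2Q : (1 : ℝ) < 2 ^ (Q / 2 - 1) := Real.one_lt_rpow one_lt_two (by linarith)
  have h2Q' : (0 : ℝ) < 2 ^ (Q / 2 - 1) - 1 := by linarith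
  set C1 := C * (3 + 1 / ((2 : ℝ) ^ (Q / 2 - 1) - 1)) with hC1
  have hC1' : 0 < C1 := by positivity
  set D := 2 * ((2 : ℝ) ^ Q * 4 ^ Q) with hD
  have hD0 : 0 < D := by positivity
  set σ := 2 * Q / (Q - 2) with hσ
  have hσ0 : 0 < σ := by positivity
  refine ⟨(C1 * (1 / c) ^ (1 / Q) * (4 * D) ^ (1 / σ)).toNNReal, fun φ hφ hφc hφΩ => ?_⟩
  set g : EuclideanSpace ℝ (Fin N) → ℝ := fun y => ‖xGrad X φ y‖ with hg
  have hgc : Continuous g := (continuous_xGrad hX.continuous hφ).norm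
  have hgcs : HasCompactSupport g := (hasCompactSupport_xGrad hφc).norm
  have hgi : Integrable g := hgc.integrable_of_hasCompactSupport hgcs
  have hg0 : ∀ y, 0 ≤ g y := fun y => norm_nonneg _
  have hg2c : Continuous (fun y => g y ^ 2) := hgc.pow 2
  have hg2i : Integrable (fun y => g y ^ 2) := hg2c.integrable_of_hasCompactSupport
    (hgcs.comp_left (g := fun t : ℝ => t ^ 2) (by simp))
  set G := ∫ y, g y ^ 2 with hG
  have hG0 : 0 ≤ G := integral_nonneg fun _ => sq_nonneg _
  have hBfin : ∀ x ∈ Ω, ∀ r, volume (ccBall U X x r) ≠ ⊤ := fun x hx r =>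
    (hX.volume_ccBall_lt_top hQ0.le hx r).ne
  -- Cauchy-Schwarz on the ball and the lower volume bound `c r^Q` give the decay `r^(-Q/2)` of the
  -- averages.
  have havg : ∀ x ∈ Ω, ∀ j : ℕ, (⨍ y in ccBall U X x (ν * (R * (1 / 2) ^ j)), g y) ^ 2 *
      (c * (R * (1 / 2) ^ j) ^ Q) ≤ G := by
    intro x hx j
    refine (mul_le_mul_of_nonneg_left (hvol x hx j) (sq_nonneg _)).trans ?_
    refine (sq_setAverage_mul_le (hBfin x hx _) hgi.integrableOn hg2i.integrableOn).trans ?_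
    exact setIntegral_le_integral hg2i (Eventually.of_forall fun _ => sq_nonneg _)
  have ha0 : ∀ x, ∀ j : ℕ, 0 ≤ ⨍ y in ccBall U X x (ν * (R * (1 / 2) ^ j)), g y := fun x j =>
    integral_nonneg fun _ => hg0 _
  -- Hedberg's splitting needs a positive `b`. If the gradient has zero energy, all averages vanish
  -- and so does `φ`.
  rcases hG0.eq_or_lt with hGz | hGpos
  · have hz : ∀ x ∈ Ω, φ x = 0 := by
      intro x hx
      have h1 : ∀ j : ℕ, ⨍ y in ccBall U X x (ν * (R * (1 / 2) ^ j)), g y = 0 := fun j => by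
        have h2 := havg x hx j
        rw [← hGz] at h2
        have h3 : 0 < c * (R * (1 / 2) ^ j) ^ Q := by positivity
        have h4 : (⨍ y in ccBall U X x (ν * (R * (1 / 2) ^ j)), g y) ^ 2 ≤ 0 := by
          by_contra h
          exact absurd h2 (not_le.2 (mul_pos (not_le.1 h) h3))
        exact pow_eq_zero_iff two_ne_zero |>.1 (le_antisymm h4 (sq_nonneg _))
      have := hdy φ hφ hφc hφΩ x hx 0 (fun n => (Finset.sum_eq_zero fun j _ => by
        rw [show (⨍ y in ccBall U X x (ν * (R * (1 / 2) ^ j)), ‖xGrad X φ y‖) = 0 from h1 j,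
          mul_zero]).le)
      rw [mul_zero] at this
      exact abs_eq_zero.1 (le_antisymm this (abs_nonneg _))
    have : φ =ᵐ[volume.restrict Ω] 0 :=
      (ae_restrict_iff' hΩ.measurableSet).2 (Eventually.of_forall hz)
    rw [eLpNorm_congr_ae this]
    simp
  set b := (G / c) ^ (1 / 2 : ℝ) with hb
  have hb0 : 0 < b := by positivity
  have hab : ∀ x ∈ Ω, ∀ j : ℕ, ⨍ y in ccBall U X x (ν * (R * (1 / 2) ^ j)), g y ≤
      b * (R * (1 / 2) ^ j) ^ (-(Q / 2)) := by
    intro x hx j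
    have h1 := havg x hx j
    set a := ⨍ y in ccBall U X x (ν * (R * (1 / 2) ^ j)), g y
    set r := R * (1 / 2) ^ j
    have hr : 0 < r := by positivity
    refine le_of_sq_le_sq ?_ (by positivity)
    have h2 : (b * r ^ (-(Q / 2))) ^ 2 = G / c * (r ^ Q)⁻¹ := by
      rw [mul_pow, hb, ← Real.rpow_natCast, ← Real.rpow_natCast, ← Real.rpow_mul (by positivity),
        ← Real.rpow_mul hr.le, ← Real.rpow_neg hr.le]
      norm_num
    rw [h2, ← div_eq_mul_inv, div_div, le_div_iff₀ (by positivity)]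
    exact h1
  set B := C1 * b ^ (2 / Q) with hB
  have hB0 : 0 < B := by positivity
  -- The exponent `Q / (Q - 2)` inverts Hedberg's power `1 - 2 / Q`, so `w` is bounded by the
  -- maximal function of `g`. The square of `w` is a multiple of `|φ| ^ σ`.
  set w : EuclideanSpace ℝ (Fin N) → ℝ := fun x => (|φ x| / B) ^ (Q / (Q - 2)) with hw
  have hwm : Measurable w := by
    have := hφ.continuous.measurable
    fun_prop
  have hw0 : ∀ x, 0 ≤ w x := fun x => by positivity
  have hmain := lintegral_sq_le_of_weak_type (μ := volume.restrict Ω) (ν := volume) hwm hw0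
    hgc.measurable hg0 hD0.le (fun t ht => by
      rw [Measure.restrict_apply (measurableSet_lt measurable_const hwm)]
      refine le_trans (measure_mono ?_) (hX.weak_type_maximal hQ0.le hΩU hgc.measurable hg0 hgi
        (R := ν * R) ht)
      rintro x ⟨hx1, hx⟩
      refine ⟨hx, ?_⟩
      -- If no average exceeds `t`, Hedberg's inequality with `s = t` forces `w x ≤ t`. Only level
      -- sets are compared, so the maximal function itself is never formed.
      by_contra! hcon
      have h1 : ∀ j : ℕ, ⨍ y in ccBall U X x (ν * (R * (1 / 2) ^ j)), g y ≤ t := fun j => by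
        refine hcon _ (by positivity) ?_
        have : (1 / 2 : ℝ) ^ j ≤ 1 := pow_le_one₀ (by norm_num) (by norm_num)
        gcongr
        nlinarith
      have h2 := hdy φ hφ hφc hφΩ x hx _ (sum_dyadic_le hQ hR ht hb0 h1 (hab x hx))
      have h3 : |φ x| / B ≤ t ^ (1 - 2 / Q) := by
        rw [div_le_iff₀ hB0]
        refine h2.trans_eq ?_
        rw [hB, hC1]
        ring
      have h4 : w x ≤ t := by
        refine (Real.rpow_le_rpow (by positivity) h3 (by positivity)).trans_eq ?_
        rw [← Real.rpow_mul ht.le, show (1 - 2 / Q) * (Q / (Q - 2)) = 1 by field_simp,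
          Real.rpow_one]
      exact absurd hx1 (not_lt.2 h4))
  have hw2 : ∀ x, w x ^ 2 = |φ x| ^ σ / B ^ σ := fun x => by
    rw [hw, ← Real.rpow_natCast, ← Real.rpow_mul (by positivity),
      ← Real.div_rpow (abs_nonneg _) hB0.le, hσ]
    congr 1
    push_cast
    ring
  have hlG : ∫⁻ x, ENNReal.ofReal (g x ^ 2) = ENNReal.ofReal G :=
    (ofReal_integral_eq_lintegral_ofReal hg2i (Eventually.of_forall fun _ => sq_nonneg _)).symm
  have hφσ : ∫⁻ x in Ω, ‖φ x‖ₑ ^ σ ≤ ENNReal.ofReal (B ^ σ * (4 * D * G)) := by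
    have h1 : ∀ x, ‖φ x‖ₑ ^ σ = ENNReal.ofReal (B ^ σ) * ENNReal.ofReal (w x ^ 2) := fun x => by
      rw [← ENNReal.ofReal_mul (by positivity), hw2, mul_div_cancel₀ _ (by positivity),
        ← ofReal_norm, ENNReal.ofReal_rpow_of_nonneg (norm_nonneg _) hσ0.le,
        Real.norm_eq_abs]
    simp only [h1]
    rw [lintegral_const_mul' _ _ ENNReal.ofReal_ne_top, ENNReal.ofReal_mul (by positivity)]
    refine mul_le_mul' le_rfl (hmain.trans_eq ?_)
    rw [hlG, ENNReal.ofReal_mul (p := 4 * D) (by positivity)]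
  have hgΩ : eLpNorm (xGrad X φ) 2 (volume.restrict Ω) = ENNReal.ofReal (G ^ (1 / 2 : ℝ)) := by
    rw [eLpNorm_eq_lintegral_rpow_enorm_toReal (by norm_num) (by norm_num),
      ← ENNReal.ofReal_rpow_of_nonneg hG0 (by norm_num), ← hlG]
    norm_num
    congr 1
    have h1 : ∀ x, ‖xGrad X φ x‖ₑ ^ 2 = ENNReal.ofReal (g x ^ 2) := fun x => by
      rw [← ofReal_norm, ENNReal.ofReal_pow (norm_nonneg _)]
    simp only [h1]
    refine setLIntegral_eq_of_support_subset fun x hx => ?_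
    by_contra hxΩ
    refine hx ?_
    have : xGrad X φ x = 0 := xGrad_eq_zero_of_notMem_tsupport fun h => hxΩ (hφΩ h)
    simp [hg, this]
  have hσt : (ENNReal.ofReal σ).toReal = σ := ENNReal.toReal_ofReal hσ0.le
  rw [hgΩ, eLpNorm_eq_lintegral_rpow_enorm_toReal (by simpa using hσ0) ENNReal.ofReal_ne_top, hσt]
  refine (ENNReal.rpow_le_rpow hφσ (by positivity)).trans_eq ?_
  rw [ENNReal.ofReal_rpow_of_nonneg (by positivity) (by positivity), ENNReal.ofReal,
    ENNReal.ofReal, ← ENNReal.coe_mul, ← Real.toNNReal_mul (by positivity)]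
  congr 2
  rw [Real.mul_rpow (by positivity) (by positivity), ← Real.rpow_mul hB0.le,
    mul_one_div_cancel hσ0.ne', Real.rpow_one, Real.mul_rpow (by positivity) hG0, hB, hb,
    ← Real.rpow_mul (by positivity), show (1 / 2 : ℝ) * (2 / Q) = 1 / Q by field_simp,
    div_eq_mul_one_div G c, Real.mul_rpow hG0 (by positivity)]
  -- The power `1 / Q` of the energy comes from `b ^ (2 / Q)`, the power `1 / σ` from the maximal
  -- inequality, and `1 / Q + 1 / σ = 1 / 2`.
  have hsplit : G ^ (1 / 2 : ℝ) = G ^ (1 / Q) * G ^ (1 / σ) := by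
    rw [← Real.rpow_add hGpos]
    congr 1
    rw [hσ]
    field_simp
    ring
  rw [hsplit]
  ring

end SobolevInequality

end XElliptic

namespace XElliptic

/-! ### Convergence and pairings in Lebesgue spaces. -/

section Convergence

variable {α E : Type*} [MeasurableSpace α] {μ : Measure α} [NormedAddCommGroup E]

theorem tendsto_eLpNorm_zero_of_dominated {q : ℝ≥0∞} (hq0 : q ≠ 0) (hq : q ≠ ⊤) {f : ℕ → α → E}
    {b : α → ℝ} (hf : ∀ n, AEStronglyMeasurable (f n) μ) (hb : MemLp b q μ)
    (hfb : ∀ n, ∀ᵐ x ∂μ, ‖f n x‖ ≤ ‖b x‖)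
    (hlim : ∀ᵐ x ∂μ, Tendsto (fun n => f n x) atTop (𝓝 0)) :
    Tendsto (fun n => eLpNorm (f n) q μ) atTop (𝓝 0) := by
  have hq' : 0 < q.toReal := ENNReal.toReal_pos hq0 hq
  have h1 : Tendsto (fun n => ∫⁻ x, ‖f n x‖ₑ ^ q.toReal ∂μ) atTop (𝓝 (∫⁻ _, 0 ∂μ)) := by
    refine tendsto_lintegral_of_dominated_convergence' (fun x => ‖b x‖ₑ ^ q.toReal)
      (fun n => (hf n).enorm.pow_const _) (fun n => ?_) ?_ ?_
    · filter_upwards [hfb n] with x hx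
      exact ENNReal.rpow_le_rpow (enorm_le_iff_norm_le.2 hx) hq'.le
    · exact (lintegral_rpow_enorm_lt_top_of_eLpNorm_lt_top hq0 hq hb.2).ne
    · filter_upwards [hlim] with x hx
      have h2 : Tendsto (fun n => ‖f n x‖ₑ) atTop (𝓝 0) := by simpa using hx.enorm
      have := h2.ennrpow_const q.toReal
      rwa [ENNReal.zero_rpow_of_pos hq'] at this
  rw [lintegral_zero] at h1
  have h3 := h1.ennrpow_const (1 / q.toReal)
  rw [ENNReal.zero_rpow_of_pos (by positivity)] at h3
  simpa only [eLpNorm_eq_lintegral_rpow_enorm_toReal hq0 hq] using h3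

theorem exists_subseq_ae_of_tendsto_eLpNorm {q : ℝ≥0∞} (hq0 : q ≠ 0) {f : ℕ → α → E} {g : α → E}
    (hf : ∀ n, AEStronglyMeasurable (f n) μ) (hg : AEStronglyMeasurable g μ)
    (h : Tendsto (fun n => eLpNorm (fun x => f n x - g x) q μ) atTop (𝓝 0)) :
    ∃ ns : ℕ → ℕ, StrictMono ns ∧
      ∀ᵐ x ∂μ, Tendsto (fun i => f (ns i) x) atTop (𝓝 (g x)) :=
  (tendstoInMeasure_of_tendsto_eLpNorm hq0 hf hg h).exists_seq_tendsto_ae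

theorem integrable_inner_of_memLp [InnerProductSpace ℝ E] {p q : ℝ≥0∞} [p.HolderConjugate q]
    {f g : α → E} (hf : MemLp f p μ) (hg : MemLp g q μ) :
    Integrable (fun x => inner ℝ (f x) (g x)) μ :=
  memLp_one_iff_integrable.1 ((innerSL ℝ).memLp_of_bilin 1 hf hg)

end Convergence

/-! ### Test functions and their `X`-gradients. -/

section TestFunctions

variable {N m : ℕ} {Ω : Set (EuclideanSpace ℝ (Fin N))}
  {X : Fin m → EuclideanSpace ℝ (Fin N) → EuclideanSpace ℝ (Fin N)}

/-- The class `C_c^∞(Ω)`. -/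
def IsTestFunction (Ω : Set (EuclideanSpace ℝ (Fin N))) (φ : EuclideanSpace ℝ (Fin N) → ℝ) :
    Prop :=
  ContDiff ℝ ((⊤ : ℕ∞) : WithTop ℕ∞) φ ∧ HasCompactSupport φ ∧ tsupport φ ⊆ Ω

variable {φ ψ : EuclideanSpace ℝ (Fin N) → ℝ}

theorem IsTestFunction.contDiff_one (h : IsTestFunction Ω φ) : ContDiff ℝ 1 φ :=
  h.1.of_le (by exact_mod_cast le_top)

theorem IsTestFunction.differentiable (h : IsTestFunction Ω φ) : Differentiable ℝ φ :=
  h.contDiff_one.differentiable one_ne_zero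

theorem IsTestFunction.add (hφ : IsTestFunction Ω φ) (hψ : IsTestFunction Ω ψ) :
    IsTestFunction Ω (fun x => φ x + ψ x) :=
  ⟨hφ.1.add hψ.1, hφ.2.1.add hψ.2.1,
    (tsupport_add φ ψ).trans (Set.union_subset hφ.2.2 hψ.2.2)⟩

theorem IsTestFunction.const_mul (hφ : IsTestFunction Ω φ) (c : ℝ) :
    IsTestFunction Ω (fun x => c * φ x) :=
  ⟨contDiff_const.mul hφ.1, hφ.2.1.mul_left,
    (tsupport_smul_subset_right (fun _ => c) φ).trans hφ.2.2⟩

theorem IsTestFunction.comp (hφ : IsTestFunction Ω φ) {F : ℝ → ℝ}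
    (hF : ContDiff ℝ ((⊤ : ℕ∞) : WithTop ℕ∞) F) (hF0 : F 0 = 0) :
    IsTestFunction Ω (fun x => F (φ x)) :=
  ⟨hF.comp hφ.1, hφ.2.1.comp_left hF0, (tsupport_comp_subset hF0 φ).trans hφ.2.2⟩

theorem xGrad_add (hφ : Differentiable ℝ φ) (hψ : Differentiable ℝ ψ)
    (x : EuclideanSpace ℝ (Fin N)) :
    xGrad X (fun x => φ x + ψ x) x = xGrad X φ x + xGrad X ψ x := by
  ext j
  simp [xGrad, fderiv_fun_add (hφ x) (hψ x)]

theorem xGrad_const_mul (hφ : Differentiable ℝ φ) (c : ℝ) (x : EuclideanSpace ℝ (Fin N)) :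
    xGrad X (fun x => c * φ x) x = c • xGrad X φ x := by
  ext j
  simp [xGrad, fderiv_const_mul (hφ x) c]

theorem xGrad_comp {F : ℝ → ℝ} (hF : Differentiable ℝ F) (hφ : Differentiable ℝ φ)
    (x : EuclideanSpace ℝ (Fin N)) :
    xGrad X (fun x => F (φ x)) x = deriv F (φ x) • xGrad X φ x := by
  have h : HasFDerivAt (fun x => F (φ x)) (deriv F (φ x) • fderiv ℝ φ x) x :=
    (hF (φ x)).hasDerivAt.comp_hasFDerivAt x (hφ x).hasFDerivAt
  ext j
  simp [xGrad, h.fderiv]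

theorem IsTestFunction.aestronglyMeasurable_xGrad (hX : ∀ j, Continuous (X j))
    (hφ : IsTestFunction Ω φ) (μ : Measure (EuclideanSpace ℝ (Fin N))) :
    AEStronglyMeasurable (xGrad X φ) μ :=
  (continuous_xGrad hX hφ.contDiff_one).aestronglyMeasurable

end TestFunctions

end XElliptic

namespace XElliptic

/-! ### Calculus in the spaces `W₀^{1,q}(Ω, X)`. -/

section SobolevSpace

variable {N m : ℕ} {Ω : Set (EuclideanSpace ℝ (Fin N))}
  {X : Fin m → EuclideanSpace ℝ (Fin N) → EuclideanSpace ℝ (Fin N)} {q : ℝ≥0∞}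
  {u v : EuclideanSpace ℝ (Fin N) → ℝ} {g h : EuclideanSpace ℝ (Fin N) → EuclideanSpace ℝ (Fin m)}

theorem IsTestFunction.memW0 (hX : ∀ j, Continuous (X j)) {φ : EuclideanSpace ℝ (Fin N) → ℝ}
    (hφ : IsTestFunction Ω φ) : MemW0 Ω X q φ (xGrad X φ) where
  memLp_fun := hφ.1.continuous.memLp_of_hasCompactSupport hφ.2.1
  memLp_grad := (continuous_xGrad hX hφ.contDiff_one).memLp_of_hasCompactSupport
    (hasCompactSupport_xGrad hφ.2.1)
  approx := ⟨fun _ => φ, fun _ => hφ, by simp, by simp⟩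

theorem MemW0.congr (hu : MemW0 Ω X q u g) (huv : u =ᵐ[volume.restrict Ω] v)
    (hgh : g =ᵐ[volume.restrict Ω] h) : MemW0 Ω X q v h := by
  obtain ⟨φ, hφ, h1, h2⟩ := hu.approx
  refine ⟨hu.memLp_fun.ae_eq huv, hu.memLp_grad.ae_eq hgh, φ, hφ, ?_, ?_⟩
  · refine h1.congr fun n => eLpNorm_congr_ae ?_
    filter_upwards [huv] with x hx
    rw [hx]
  · refine h2.congr fun n => eLpNorm_congr_ae ?_
    filter_upwards [hgh] with x hx
    rw [hx]

theorem MemW0.add (hX : ∀ j, Continuous (X j)) (hq : 1 ≤ q) (hu : MemW0 Ω X q u g)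
    (hv : MemW0 Ω X q v h) : MemW0 Ω X q (fun x => u x + v x) (fun x => g x + h x) := by
  obtain ⟨φ, hφ, h1, h2⟩ := hu.approx
  obtain ⟨ψ, hψ, h3, h4⟩ := hv.approx
  have hφ' : ∀ n, IsTestFunction Ω (φ n) := hφ
  have hψ' : ∀ n, IsTestFunction Ω (ψ n) := hψ
  refine ⟨hu.memLp_fun.add hv.memLp_fun, hu.memLp_grad.add hv.memLp_grad,
    fun n x => φ n x + ψ n x, fun n => (hφ' n).add (hψ' n), ?_, ?_⟩
  · have h5 := h1.add h3
    rw [add_zero] at h5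
    refine tendsto_of_tendsto_of_tendsto_of_le_of_le tendsto_const_nhds h5
      (fun _ => zero_le) fun n => ?_
    have := eLpNorm_add_le (μ := volume.restrict Ω) (p := q)
      ((hφ' n).1.continuous.aestronglyMeasurable.sub hu.memLp_fun.1)
      ((hψ' n).1.continuous.aestronglyMeasurable.sub hv.memLp_fun.1) hq
    refine le_trans (le_of_eq ?_) this
    congr 1
    ext x
    simp only [Pi.add_apply, Pi.sub_apply]
    ring
  · have h5 := h2.add h4
    rw [add_zero] at h5
    refine tendsto_of_tendsto_of_tendsto_of_le_of_le tendsto_const_nhds h5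
      (fun _ => zero_le) fun n => ?_
    have := eLpNorm_add_le (μ := volume.restrict Ω) (p := q)
      (((hφ' n).aestronglyMeasurable_xGrad hX _).sub hu.memLp_grad.1)
      (((hψ' n).aestronglyMeasurable_xGrad hX _).sub hv.memLp_grad.1) hq
    refine le_trans (le_of_eq ?_) this
    congr 1
    ext1 x
    simp only [Pi.add_apply, Pi.sub_apply]
    rw [xGrad_add (hφ' n).differentiable (hψ' n).differentiable]
    abel

theorem MemW0.const_smul (hu : MemW0 Ω X q u g) (c : ℝ) :
    MemW0 Ω X q (fun x => c * u x) (fun x => c • g x) := by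
  obtain ⟨φ, hφ, h1, h2⟩ := hu.approx
  have hφ' : ∀ n, IsTestFunction Ω (φ n) := hφ
  refine ⟨hu.memLp_fun.const_mul c, hu.memLp_grad.const_smul c,
    fun n x => c * φ n x, fun n => (hφ' n).const_mul c, ?_, ?_⟩
  · have h5 := ENNReal.Tendsto.const_mul (a := ‖c‖ₑ) h1 (Or.inr enorm_ne_top)
    rw [mul_zero] at h5
    refine h5.congr fun n => ?_
    rw [← eLpNorm_const_smul]
    congr 1
    ext x
    simp [mul_sub]
  · have h5 := ENNReal.Tendsto.const_mul (a := ‖c‖ₑ) h2 (Or.inr enorm_ne_top)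
    rw [mul_zero] at h5
    refine h5.congr fun n => ?_
    rw [← eLpNorm_const_smul]
    congr 1
    ext1 x
    simp only [Pi.smul_apply, smul_sub]
    rw [xGrad_const_mul (hφ' n).differentiable]

theorem MemW0.sub (hX : ∀ j, Continuous (X j)) (hq : 1 ≤ q) (hu : MemW0 Ω X q u g)
    (hv : MemW0 Ω X q v h) : MemW0 Ω X q (fun x => u x - v x) (fun x => g x - h x) := by
  simpa [sub_eq_add_neg] using hu.add hX hq (hv.const_smul (-1))

theorem MemW0.mono_exponent [IsFiniteMeasure (volume.restrict Ω)] (hX : ∀ j, Continuous (X j))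
    {r : ℝ≥0∞} (hr : r ≤ q) (hr0 : r ≠ 0) (hu : MemW0 Ω X q u g) : MemW0 Ω X r u g := by
  obtain ⟨φ, hφ, h1, h2⟩ := hu.approx
  have hφ' : ∀ n, IsTestFunction Ω (φ n) := hφ
  have hfin : (volume.restrict Ω) Set.univ ^ (1 / r.toReal - 1 / q.toReal) ≠ ⊤ := by
    refine ENNReal.rpow_ne_top_of_nonneg ?_ (measure_ne_top _ _)
    rcases eq_or_ne q ⊤ with rfl | hq
    · simp
    · have hr' : 0 < r.toReal := ENNReal.toReal_pos hr0 (ne_top_of_le_ne_top hq hr)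
      exact sub_nonneg.2 (one_div_le_one_div_of_le hr' (ENNReal.toReal_mono hq hr))
  refine ⟨hu.memLp_fun.mono_exponent hr, hu.memLp_grad.mono_exponent hr, φ, hφ, ?_, ?_⟩
  · have h5 := ENNReal.Tendsto.mul_const h1 (Or.inr hfin)
    rw [zero_mul] at h5
    exact tendsto_of_tendsto_of_tendsto_of_le_of_le tendsto_const_nhds h5
      (fun _ => zero_le) fun n => eLpNorm_le_eLpNorm_mul_rpow_measure_univ hr
        ((hφ' n).1.continuous.aestronglyMeasurable.sub hu.memLp_fun.1)
  · have h5 := ENNReal.Tendsto.mul_const h2 (Or.inr hfin)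
    rw [zero_mul] at h5
    exact tendsto_of_tendsto_of_tendsto_of_le_of_le tendsto_const_nhds h5
      (fun _ => zero_le) fun n => eLpNorm_le_eLpNorm_mul_rpow_measure_univ hr
        (((hφ' n).aestronglyMeasurable_xGrad hX _).sub hu.memLp_grad.1)

/-- `W₀^{1,q}(Ω, X)` is closed under strong limits. -/
theorem MemW0.of_tendsto (hX : ∀ j, Continuous (X j)) (hq : 1 ≤ q)
    {un : ℕ → EuclideanSpace ℝ (Fin N) → ℝ}
    {gn : ℕ → EuclideanSpace ℝ (Fin N) → EuclideanSpace ℝ (Fin m)}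
    (hn : ∀ n, MemW0 Ω X q (un n) (gn n)) (hu : MemLp u q (volume.restrict Ω))
    (hg : MemLp g q (volume.restrict Ω))
    (hun : Tendsto (fun n => eLpNorm (fun x => un n x - u x) q (volume.restrict Ω)) atTop (𝓝 0))
    (hgn : Tendsto (fun n => eLpNorm (fun x => gn n x - g x) q (volume.restrict Ω)) atTop (𝓝 0)) :
    MemW0 Ω X q u g := by
  have hex : ∀ n : ℕ, ∃ φ, IsTestFunction Ω φ ∧
      eLpNorm (fun x => φ x - un n x) q (volume.restrict Ω) ≤ ENNReal.ofReal (1 / (n + 1)) ∧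
      eLpNorm (fun x => xGrad X φ x - gn n x) q (volume.restrict Ω) ≤
        ENNReal.ofReal (1 / (n + 1)) := by
    intro n
    obtain ⟨φ, hφ, h1, h2⟩ := (hn n).approx
    have hpos : (0 : ℝ≥0∞) < ENNReal.ofReal (1 / (n + 1)) := ENNReal.ofReal_pos.2 (by positivity)
    obtain ⟨k, hk1, hk2⟩ := ((h1.eventually (gt_mem_nhds hpos)).and
      (h2.eventually (gt_mem_nhds hpos))).exists
    exact ⟨φ k, hφ k, hk1.le, hk2.le⟩
  choose φ hφ h1 h2 using hex
  have hlim : Tendsto (fun n : ℕ => ENNReal.ofReal (1 / (n + 1))) atTop (𝓝 0) := by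
    have := ENNReal.tendsto_ofReal (tendsto_one_div_add_atTop_nhds_zero_nat (𝕜 := ℝ))
    rwa [ENNReal.ofReal_zero] at this
  refine ⟨hu, hg, φ, hφ, ?_, ?_⟩
  · have h5 := hlim.add hun
    rw [add_zero] at h5
    refine tendsto_of_tendsto_of_tendsto_of_le_of_le tendsto_const_nhds h5
      (fun _ => zero_le) fun n => ?_
    have := eLpNorm_add_le (μ := volume.restrict Ω) (p := q)
      ((hφ n).1.continuous.aestronglyMeasurable.sub (hn n).memLp_fun.1)
      ((hn n).memLp_fun.1.sub hu.1) hq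
    refine le_trans (le_of_eq ?_) (this.trans (add_le_add (h1 n) le_rfl))
    congr 1
    ext x
    simp
  · have h5 := hlim.add hgn
    rw [add_zero] at h5
    refine tendsto_of_tendsto_of_tendsto_of_le_of_le tendsto_const_nhds h5
      (fun _ => zero_le) fun n => ?_
    have := eLpNorm_add_le (μ := volume.restrict Ω) (p := q)
      (((hφ n).aestronglyMeasurable_xGrad hX _).sub (hn n).memLp_grad.1)
      ((hn n).memLp_grad.1.sub hg.1) hq
    refine le_trans (le_of_eq ?_) (this.trans (add_le_add (h2 n) le_rfl))
    congr 1
    ext1 x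
    simp

/-- The chain rule in `W₀^{1,q}(Ω, X)`. -/
theorem MemW0.comp (hX : ∀ j, Continuous (X j)) (hq : 1 ≤ q) (hqt : q ≠ ⊤)
    (hu : MemW0 Ω X q u g) {F : ℝ → ℝ} (hF : ContDiff ℝ ((⊤ : ℕ∞) : WithTop ℕ∞) F)
    (hF0 : F 0 = 0) {K : ℝ≥0} (hK : ∀ t, ‖deriv F t‖₊ ≤ K) :
    MemW0 Ω X q (fun x => F (u x)) (fun x => deriv F (u x) • g x) := by
  have hq0 : q ≠ 0 := (zero_lt_one.trans_le hq).ne'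
  have hF1 : ContDiff ℝ 1 F := hF.of_le (by exact_mod_cast le_top)
  have hFd : Differentiable ℝ F := hF1.differentiable one_ne_zero
  have hF' : Continuous (deriv F) := hF1.continuous_deriv le_rfl
  have hlip : LipschitzWith K F := lipschitzWith_of_nnnorm_deriv_le hFd hK
  obtain ⟨φ₀, hφ₀, h1₀, h2₀⟩ := hu.approx
  -- Almost everywhere convergence is needed to pass to the limit in `deriv F (φ n)`.
  obtain ⟨ns, hns, hae⟩ := exists_subseq_ae_of_tendsto_eLpNorm hq0
    (fun n => (hφ₀ n).1.continuous.aestronglyMeasurable) hu.memLp_fun.1 h1₀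
  set φ := fun n => φ₀ (ns n) with hφdef
  have hφ : ∀ n, IsTestFunction Ω (φ n) := fun n => hφ₀ (ns n)
  have h1 := h1₀.comp hns.tendsto_atTop
  have h2 := h2₀.comp hns.tendsto_atTop
  have hFu : AEStronglyMeasurable (fun x => deriv F (u x)) (volume.restrict Ω) :=
    hF'.comp_aestronglyMeasurable hu.memLp_fun.1
  have hFφ : ∀ n, AEStronglyMeasurable (fun x => deriv F (φ n x)) (volume.restrict Ω) :=
    fun n => (hF'.comp (hφ n).1.continuous).aestronglyMeasurable
  refine ⟨?_, ?_, fun n x => F (φ n x), fun n => (hφ n).comp hF hF0, ?_, ?_⟩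
  · refine hu.memLp_fun.of_le_mul (c := K)
      (hF1.continuous.comp_aestronglyMeasurable hu.memLp_fun.1) (Eventually.of_forall fun x => ?_)
    have := hlip.norm_sub_le (u x) 0
    simpa [hF0] using this
  · refine hu.memLp_grad.of_le_mul (c := K) (hFu.smul hu.memLp_grad.1)
      (Eventually.of_forall fun x => ?_)
    rw [norm_smul]
    exact mul_le_mul_of_nonneg_right (hK _) (norm_nonneg _)
  · have h5 := ENNReal.Tendsto.const_mul (a := (K : ℝ≥0∞)) h1 (Or.inr ENNReal.coe_ne_top)
    rw [mul_zero] at h5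
    refine tendsto_of_tendsto_of_tendsto_of_le_of_le tendsto_const_nhds h5
      (fun _ => zero_le) fun n => ?_
    exact eLpNorm_le_nnreal_smul_eLpNorm_of_ae_le_mul
      (Eventually.of_forall fun x => hlip.norm_sub_le _ _) q
  · have h5 := ENNReal.Tendsto.const_mul (a := (K : ℝ≥0∞)) h2 (Or.inr ENNReal.coe_ne_top)
    rw [mul_zero] at h5
    -- The error splits as `F'(φ_n) (Xφ_n - g) + (F'(φ_n) - F'(u)) g`; the second term tends to zero
    -- by dominated convergence, with dominating function `2 K ‖g‖`.
    have h6 : Tendsto (fun n => eLpNorm (fun x => (deriv F (φ n x) - deriv F (u x)) • g x) q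
        (volume.restrict Ω)) atTop (𝓝 0) := by
      refine tendsto_eLpNorm_zero_of_dominated hq0 hqt
        (fun n => ((hFφ n).sub hFu).smul hu.memLp_grad.1)
        (hu.memLp_grad.norm.const_mul (2 * K : ℝ)) (fun n => Eventually.of_forall fun x => ?_) ?_
      · rw [norm_smul, norm_mul, norm_norm, Real.norm_of_nonneg (by positivity : (0:ℝ) ≤ 2 * K)]
        refine mul_le_mul_of_nonneg_right ((norm_sub_le _ _).trans ?_) (norm_nonneg _)
        have e1 : ‖deriv F (φ n x)‖ ≤ K := hK _
        have e2 : ‖deriv F (u x)‖ ≤ K := hK _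
        linarith
      · filter_upwards [hae] with x hx
        have e1 : Tendsto (fun n => deriv F (φ n x)) atTop (𝓝 (deriv F (u x))) :=
          (hF'.tendsto _).comp hx
        have e2 := (e1.sub_const (deriv F (u x))).smul_const (g x)
        simpa using e2
    have h7 := h5.add h6
    rw [add_zero] at h7
    refine tendsto_of_tendsto_of_tendsto_of_le_of_le tendsto_const_nhds h7
      (fun _ => zero_le) fun n => ?_
    have hXm := ((hφ n).aestronglyMeasurable_xGrad hX (volume.restrict Ω)).sub hu.memLp_grad.1
    have h8 := eLpNorm_add_le (μ := volume.restrict Ω) (p := q) ((hFφ n).smul hXm)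
      (((hFφ n).sub hFu).smul hu.memLp_grad.1) hq
    refine le_trans (le_of_eq ?_) (h8.trans (add_le_add ?_ le_rfl))
    · congr 1
      ext1 x
      simp only [Pi.add_apply, Pi.smul_apply', Pi.sub_apply]
      rw [xGrad_comp hFd (hφ n).differentiable, smul_sub, sub_smul]
      abel
    · refine eLpNorm_le_nnreal_smul_eLpNorm_of_ae_le_mul (Eventually.of_forall fun x => ?_) q
      simp only [Pi.smul_apply', nnnorm_smul]
      exact mul_le_mul' (hK _) le_rfl

/-- Fatou's lemma along an almost everywhere convergent subsequence of test functions; convergence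
in `L^s` is not required. -/
theorem MemW0.sobolev (hX : ∀ j, Continuous (X j)) {s : ℝ≥0∞} {S : ℝ≥0} (hq : 1 ≤ q)
    (hS : ∀ φ : EuclideanSpace ℝ (Fin N) → ℝ, ContDiff ℝ 1 φ → HasCompactSupport φ →
      tsupport φ ⊆ Ω →
      eLpNorm φ s (volume.restrict Ω) ≤ S * eLpNorm (xGrad X φ) q (volume.restrict Ω))
    (hu : MemW0 Ω X q u g) :
    eLpNorm u s (volume.restrict Ω) ≤ S * eLpNorm g q (volume.restrict Ω) := by
  obtain ⟨φ₀, hφ₀, h1₀, h2₀⟩ := hu.approx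
  have hφ' : ∀ n, IsTestFunction Ω (φ₀ n) := hφ₀
  obtain ⟨ns, hns, hae⟩ := exists_subseq_ae_of_tendsto_eLpNorm (zero_lt_one.trans_le hq).ne'
    (fun n => (hφ₀ n).1.continuous.aestronglyMeasurable) hu.memLp_fun.1 h1₀
  have h2 := h2₀.comp hns.tendsto_atTop
  refine (Lp.eLpNorm_lim_le_liminf_eLpNorm
    (fun n => (hφ₀ (ns n)).1.continuous.aestronglyMeasurable) u hae).trans ?_
  have hle : ∀ n, eLpNorm (φ₀ (ns n)) s (volume.restrict Ω) ≤
      S * (eLpNorm (fun x => xGrad X (φ₀ (ns n)) x - g x) q (volume.restrict Ω) +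
        eLpNorm g q (volume.restrict Ω)) := fun n => by
    refine (hS _ (hφ' _).contDiff_one (hφ' _).2.1 (hφ' _).2.2).trans (mul_le_mul' le_rfl ?_)
    have := eLpNorm_add_le (μ := volume.restrict Ω) (p := q)
      (((hφ' (ns n)).aestronglyMeasurable_xGrad hX _).sub hu.memLp_grad.1) hu.memLp_grad.1 hq
    rwa [sub_add_cancel] at this
  have hlim : Tendsto (fun n => S * (eLpNorm (fun x => xGrad X (φ₀ (ns n)) x - g x) q
      (volume.restrict Ω) + eLpNorm g q (volume.restrict Ω))) atTop
      (𝓝 (S * eLpNorm g q (volume.restrict Ω))) := by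
    have h5 := ENNReal.Tendsto.const_mul (a := (S : ℝ≥0∞))
      (h2.add_const (eLpNorm g q (volume.restrict Ω))) (Or.inr ENNReal.coe_ne_top)
    rwa [zero_add] at h5
  rw [← hlim.liminf_eq]
  exact liminf_le_liminf (Eventually.of_forall hle)

end SobolevSpace

end XElliptic

namespace XElliptic

/-! ### Weak solutions: linearity and existence. -/

section WeakSolutions

variable {N m : ℕ} {Ω : Set (EuclideanSpace ℝ (Fin N))}
  {X : Fin m → EuclideanSpace ℝ (Fin N) → EuclideanSpace ℝ (Fin N)}
  {A : EuclideanSpace ℝ (Fin N) → Matrix (Fin m) (Fin m) ℝ} {α β : ℝ}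
  {f f₁ f₂ u u₁ u₂ : EuclideanSpace ℝ (Fin N) → ℝ}
  {g g₁ g₂ h : EuclideanSpace ℝ (Fin N) → EuclideanSpace ℝ (Fin m)}

theorem inner_toEuclideanCLM (M : Matrix (Fin m) (Fin m) ℝ) (a b : EuclideanSpace ℝ (Fin m)) :
    inner ℝ b (Matrix.toEuclideanCLM (𝕜 := ℝ) M a) = M.mulVec a.ofLp ⬝ᵥ b.ofLp := by
  rw [EuclideanSpace.inner_eq_star_dotProduct]
  simp

/-- The expansion in elementary matrices transfers measurability and boundedness from the entries of
`A` to the field of operators. -/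
theorem toEuclideanCLM_eq_sum (M : Matrix (Fin m) (Fin m) ℝ) :
    Matrix.toEuclideanCLM (𝕜 := ℝ) M =
      ∑ i, ∑ j, M i j • Matrix.toEuclideanCLM (𝕜 := ℝ) (Matrix.single i j (1 : ℝ)) := by
  conv_lhs => rw [Matrix.matrix_eq_sum_single M]
  simp only [map_sum]
  refine Finset.sum_congr rfl fun i _ => Finset.sum_congr rfl fun j _ => ?_
  rw [← map_smul, Matrix.smul_single, smul_eq_mul, mul_one]

theorem IsElliptic.memLp_toEuclideanCLM (hA : IsElliptic Ω α β A) :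
    MemLp (fun x => Matrix.toEuclideanCLM (𝕜 := ℝ) (A x)) ⊤ (volume.restrict Ω) := by
  obtain ⟨M, hM⟩ := hA.bounded
  refine memLp_top_of_bound (C := ∑ i : Fin m, ∑ j : Fin m,
    M * ‖Matrix.toEuclideanCLM (𝕜 := ℝ) (Matrix.single i j (1 : ℝ))‖) ?_ ?_
  · have : (fun x => Matrix.toEuclideanCLM (𝕜 := ℝ) (A x)) = fun x =>
        ∑ i, ∑ j, A x i j • Matrix.toEuclideanCLM (𝕜 := ℝ) (Matrix.single i j (1 : ℝ)) :=
      funext fun x => toEuclideanCLM_eq_sum (A x)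
    rw [this]
    refine Finset.aestronglyMeasurable_fun_sum _ fun i _ =>
      Finset.aestronglyMeasurable_fun_sum _ fun j _ => ?_
    exact (hA.measurable i j).aestronglyMeasurable.smul_const _
  · filter_upwards [hM] with x hx
    rw [toEuclideanCLM_eq_sum]
    refine norm_sum_le_of_le _ fun i _ => norm_sum_le_of_le _ fun j _ => ?_
    rw [norm_smul]
    exact mul_le_mul_of_nonneg_right (hx i j) (norm_nonneg _)

theorem IsElliptic.memLp_apply (hA : IsElliptic Ω α β A) (hg : MemLp g 2 (volume.restrict Ω)) :
    MemLp (fun x => Matrix.toEuclideanCLM (𝕜 := ℝ) (A x) (g x)) 2 (volume.restrict Ω) :=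
  (ContinuousLinearMap.id ℝ (EuclideanSpace ℝ (Fin m) →L[ℝ] EuclideanSpace ℝ (Fin m))).memLp_of_bilin
    (p := ⊤) (q := 2) 2 hA.memLp_toEuclideanCLM hg

theorem IsElliptic.integrable (hA : IsElliptic Ω α β A) (hg : MemLp g 2 (volume.restrict Ω))
    (hh : MemLp h 2 (volume.restrict Ω)) :
    Integrable (fun x => (A x).mulVec (g x).ofLp ⬝ᵥ (h x).ofLp) (volume.restrict Ω) := by
  refine (integrable_inner_of_memLp (p := 2) (q := 2) hh (hA.memLp_apply hg)).congr
    (Eventually.of_forall fun x => ?_)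
  exact inner_toEuclideanCLM _ _ _

/-- Linearity turns an a priori bound for one solution into a Cauchy estimate for a sequence, and
into uniqueness. -/
theorem IsWeakSolution.sub (hX : ∀ j, Continuous (X j)) (hA : IsElliptic Ω α β A)
    (hf₁ : MemLp f₁ 2 (volume.restrict Ω)) (hf₂ : MemLp f₂ 2 (volume.restrict Ω))
    (h₁ : IsWeakSolution Ω X A f₁ u₁ g₁) (h₂ : IsWeakSolution Ω X A f₂ u₂ g₂) :
    IsWeakSolution Ω X A (fun x => f₁ x - f₂ x) (fun x => u₁ x - u₂ x)
      (fun x => g₁ x - g₂ x) := by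
  refine ⟨h₁.1.sub hX one_le_two h₂.1, fun v h hv => ?_⟩
  have e1 : ∀ x, (A x).mulVec (g₁ x - g₂ x).ofLp ⬝ᵥ (h x).ofLp =
      (A x).mulVec (g₁ x).ofLp ⬝ᵥ (h x).ofLp - (A x).mulVec (g₂ x).ofLp ⬝ᵥ (h x).ofLp := fun x => by
    rw [WithLp.ofLp_sub, Matrix.mulVec_sub, sub_dotProduct]
  have e2 : ∀ x, (f₁ x - f₂ x) * v x = f₁ x * v x - f₂ x * v x := fun x => sub_mul _ _ _
  simp only [e1, e2]
  rw [integral_sub (hA.integrable h₁.1.memLp_grad hv.memLp_grad)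
      (hA.integrable h₂.1.memLp_grad hv.memLp_grad),
    integral_sub (f := fun x => f₁ x * v x) (g := fun x => f₂ x * v x)
      (hf₁.integrable_mul hv.memLp_fun) (hf₂.integrable_mul hv.memLp_fun),
    h₁.2 v h hv, h₂.2 v h hv]

/-- The graph of the `X`-gradient on `W₀^{1,2}(Ω, X)`, in the Hilbert space `L² × L²`. -/
def graphW0 (Ω : Set (EuclideanSpace ℝ (Fin N)))
    {X : Fin m → EuclideanSpace ℝ (Fin N) → EuclideanSpace ℝ (Fin N)}
    (hX : ∀ j, Continuous (X j)) :
    Submodule ℝ (WithLp 2 (Lp ℝ 2 (volume.restrict Ω) ×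
      Lp (EuclideanSpace ℝ (Fin m)) 2 (volume.restrict Ω))) where
  carrier := {z | MemW0 Ω X 2 z.fst z.snd}
  add_mem' {z w} hz hw := (MemW0.add hX one_le_two hz hw).congr
    (Lp.coeFn_add z.fst w.fst).symm (Lp.coeFn_add z.snd w.snd).symm
  zero_mem' := by
    have h0 : IsTestFunction Ω (fun _ => (0 : ℝ)) :=
      ⟨contDiff_const, HasCompactSupport.zero, by simp [tsupport]⟩
    refine (h0.memW0 hX).congr (Lp.coeFn_zero _ _ _).symm ?_
    refine EventuallyEq.trans (Eventually.of_forall fun x => ?_) (Lp.coeFn_zero _ _ _).symm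
    ext j
    simp [xGrad]
  smul_mem' c z hz := (MemW0.const_smul hz c).congr
    (Lp.coeFn_smul c z.fst).symm (Lp.coeFn_smul c z.snd).symm

/-- Closedness makes the graph a Hilbert space. Working with pairs avoids any appeal to uniqueness
of the gradient of a given function. -/
theorem isClosed_graphW0 (hX : ∀ j, Continuous (X j)) :
    IsClosed (graphW0 Ω hX : Set (WithLp 2 (Lp ℝ 2 (volume.restrict Ω) ×
      Lp (EuclideanSpace ℝ (Fin m)) 2 (volume.restrict Ω)))) := by
  refine IsSeqClosed.isClosed fun z w hz hlim => ?_
  have h1 := ((WithLp.fstL 2 ℝ _ _).continuous.tendsto w).comp hlim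
  have h2 := ((WithLp.sndL 2 ℝ _ _).continuous.tendsto w).comp hlim
  exact MemW0.of_tendsto hX one_le_two hz (Lp.memLp _) (Lp.memLp _)
    ((Lp.tendsto_Lp_iff_tendsto_eLpNorm' _ _).1 h1) ((Lp.tendsto_Lp_iff_tendsto_eLpNorm' _ _).1 h2)

/-- The Lax-Milgram theorem for a form that factors through a bounded operator. -/
theorem exists_forall_inner_eq {V F : Type*} [NormedAddCommGroup V] [InnerProductSpace ℝ V]
    [CompleteSpace V] [NormedAddCommGroup F] [InnerProductSpace ℝ F] (P : V →L[ℝ] F)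
    (T : F →L[ℝ] F) {c : ℝ} (hc : 0 < c) (h : ∀ z, c * ‖z‖ ^ 2 ≤ inner ℝ (P z) (T (P z)))
    (ℓ : V →L[ℝ] ℝ) : ∃ z, ∀ w, inner ℝ (P w) (T (P z)) = ℓ w := by
  let B : V →L[ℝ] V →L[ℝ] ℝ := (innerSL ℝ).bilinearComp (T.comp P) P
  have hB : ∀ z w : V, B z w = inner ℝ (P w) (T (P z)) := fun z w => by
    rw [real_inner_comm]
    rfl
  have hcoer : IsCoercive B := ⟨c, hc, fun z => by
    rw [mul_assoc, ← sq, hB]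
    exact h z⟩
  refine ⟨hcoer.continuousLinearEquivOfBilin.symm ((InnerProductSpace.toDual ℝ V).symm ℓ),
    fun w => ?_⟩
  rw [← hB, ← hcoer.continuousLinearEquivOfBilin_apply, ContinuousLinearEquiv.apply_symm_apply,
    InnerProductSpace.toDual_symm_apply]

theorem IsElliptic.exists_operator (hA : IsElliptic Ω α β A) :
    ∃ T : Lp (EuclideanSpace ℝ (Fin m)) 2 (volume.restrict Ω) →L[ℝ]
        Lp (EuclideanSpace ℝ (Fin m)) 2 (volume.restrict Ω),
      ∀ g h, inner ℝ h (T g) = ∫ x in Ω, (A x).mulVec (g x).ofLp ⬝ᵥ (h x).ofLp := by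
  refine ⟨(ContinuousLinearMap.id ℝ
    (EuclideanSpace ℝ (Fin m) →L[ℝ] EuclideanSpace ℝ (Fin m))).holderL (volume.restrict Ω) ⊤ 2 2
      hA.memLp_toEuclideanCLM.toLp, fun g h => ?_⟩
  rw [L2.inner_def]
  refine integral_congr_ae ?_
  have h1 := (ContinuousLinearMap.id ℝ
    (EuclideanSpace ℝ (Fin m) →L[ℝ] EuclideanSpace ℝ (Fin m))).coeFn_holder (r := 2)
    hA.memLp_toEuclideanCLM.toLp g
  filter_upwards [h1, hA.memLp_toEuclideanCLM.coeFn_toLp] with x hx1 hx2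
  rw [← inner_toEuclideanCLM]
  congr 1
  refine hx1.trans ?_
  rw [hx2]
  rfl

theorem IsElliptic.mul_norm_sq_le (hA : IsElliptic Ω α β A)
    (g : Lp (EuclideanSpace ℝ (Fin m)) 2 (volume.restrict Ω)) :
    α * ‖g‖ ^ 2 ≤ ∫ x in Ω, (A x).mulVec (g x).ofLp ⬝ᵥ (g x).ofLp := by
  rw [← real_inner_self_eq_norm_sq, L2.inner_def, ← integral_const_mul]
  refine integral_mono_ae ((integrable_inner_of_memLp (p := 2) (q := 2) (Lp.memLp g)
    (Lp.memLp g)).const_mul α) (hA.integrable (Lp.memLp g) (Lp.memLp g)) ?_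
  filter_upwards [hA.elliptic] with x hx
  simp only [real_inner_self_eq_norm_sq]
  exact (hx _).1

/-- The form only sees the gradient component, but `hS` gives `‖u‖² + ‖g‖² ≤ (S² + 1) ‖g‖²`. Thus it
is coercive on the graph, with constant `α / (S² + 1)`, and Lax-Milgram applies. -/
theorem exists_isWeakSolution (hX : ∀ j, Continuous (X j)) (hα : 0 < α)
    (hA : IsElliptic Ω α β A) {S : ℝ≥0}
    (hS : ∀ (u : EuclideanSpace ℝ (Fin N) → ℝ)
      (g : EuclideanSpace ℝ (Fin N) → EuclideanSpace ℝ (Fin m)), MemW0 Ω X 2 u g →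
      eLpNorm u 2 (volume.restrict Ω) ≤ S * eLpNorm g 2 (volume.restrict Ω))
    (hf : MemLp f 2 (volume.restrict Ω)) :
    ∃ u g, IsWeakSolution Ω X A f u g := by
  have : CompleteSpace (graphW0 Ω hX) := (isClosed_graphW0 hX).completeSpace_coe
  obtain ⟨T, hT⟩ := hA.exists_operator
  have hcoer : ∀ z : graphW0 Ω hX,
      α / (S ^ 2 + 1) * ‖z‖ ^ 2 ≤ inner ℝ z.1.snd (T z.1.snd) := fun z => by
    have h1 : α * ‖z.1.snd‖ ^ 2 ≤ inner ℝ z.1.snd (T z.1.snd) :=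
      (hA.mul_norm_sq_le z.1.snd).trans_eq (hT _ _).symm
    have h2 : ‖z.1.fst‖ ≤ S * ‖z.1.snd‖ := by
      have h3 := ENNReal.toReal_mono
        (ENNReal.mul_ne_top ENNReal.coe_ne_top (Lp.memLp z.1.snd).2.ne) (hS _ _ z.2)
      rw [ENNReal.toReal_mul] at h3
      exact h3
    have h4 : ‖z‖ ^ 2 = ‖z.1.fst‖ ^ 2 + ‖z.1.snd‖ ^ 2 := WithLp.prod_norm_sq_eq_of_L2 z.1
    have h5 : ‖z.1.fst‖ ^ 2 ≤ (S * ‖z.1.snd‖) ^ 2 := pow_le_pow_left₀ (norm_nonneg _) h2 2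
    rw [h4, div_mul_eq_mul_div, div_le_iff₀ (by positivity)]
    refine le_trans ?_ (mul_le_mul_of_nonneg_right h1 (by positivity))
    nlinarith
  obtain ⟨z, hz⟩ := exists_forall_inner_eq
    ((WithLp.sndL 2 ℝ _ _).comp (graphW0 Ω hX).subtypeL) T
    (c := α / (S ^ 2 + 1)) (by positivity) hcoer
    ((innerSL ℝ hf.toLp).comp ((WithLp.fstL 2 ℝ _ _).comp (graphW0 Ω hX).subtypeL))
  refine ⟨z.1.fst, z.1.snd, z.2, fun v h hv => ?_⟩
  have hw := hz ⟨WithLp.toLp 2 (hv.memLp_fun.toLp, hv.memLp_grad.toLp),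
    MemW0.congr hv hv.memLp_fun.coeFn_toLp.symm hv.memLp_grad.coeFn_toLp.symm⟩
  have e1 : ∫ x in Ω, (A x).mulVec (z.1.snd x).ofLp ⬝ᵥ (hv.memLp_grad.toLp h x).ofLp =
      ∫ x in Ω, (A x).mulVec (z.1.snd x).ofLp ⬝ᵥ (h x).ofLp := by
    refine integral_congr_ae ?_
    filter_upwards [hv.memLp_grad.coeFn_toLp] with x hx
    rw [hx]
  have e2 : inner ℝ hf.toLp hv.memLp_fun.toLp = ∫ x in Ω, f x * v x := by
    rw [L2.inner_def]
    refine integral_congr_ae ?_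
    filter_upwards [hf.coeFn_toLp, hv.memLp_fun.coeFn_toLp] with x hx1 hx2
    rw [hx1, hx2]
    simp [mul_comm]
  exact e1.symm.trans ((hT z.1.snd (hv.memLp_grad.toLp h)).symm.trans (hw.trans e2))

end WeakSolutions

end XElliptic

namespace XElliptic

/-! ### Regularized powers. -/

section RegularizedPower

/-- A smooth regularization of the odd power `t ↦ t |t| ^ (2κ)`. -/
noncomputable def regPow (δ κ t : ℝ) : ℝ := t * (t ^ 2 + δ) ^ κ

variable {δ κ : ℝ}

@[simp] theorem regPow_zero (δ κ : ℝ) : regPow δ κ 0 = 0 := by simp [regPow]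

theorem contDiff_regPow (hδ : 0 < δ) : ContDiff ℝ ((⊤ : ℕ∞) : WithTop ℕ∞) (regPow δ κ) := by
  refine contDiff_id.mul (ContDiff.rpow_const_of_ne (by fun_prop) fun t => ?_)
  positivity

theorem deriv_regPow (hδ : 0 < δ) (t : ℝ) :
    deriv (regPow δ κ) t = (t ^ 2 + δ) ^ (κ - 1) * ((1 + 2 * κ) * t ^ 2 + δ) := by
  have h0 : 0 < t ^ 2 + δ := by positivity
  have h1 : HasDerivAt (fun t : ℝ => t ^ 2 + δ) (2 * t) t := by
    simpa using (hasDerivAt_pow 2 t).add_const δ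
  have h2 := (hasDerivAt_id t).mul (h1.rpow_const (p := κ) (Or.inl h0.ne'))
  refine h2.deriv.trans ?_
  rw [show (t ^ 2 + δ) ^ κ = (t ^ 2 + δ) ^ (κ - 1) * (t ^ 2 + δ) by
    rw [← Real.rpow_add_one h0.ne', sub_add_cancel]]
  simp only [id]
  ring

/-- With `κ = γ - 1` this lower bound gives coercivity when testing the equation; the matching upper
bound, with `κ = (γ - 1) / 2`, serves in the Sobolev inequality. -/
theorem le_deriv_regPow (hδ : 0 < δ) (hκ : κ ≤ 0) (t : ℝ) :
    (1 + 2 * κ) * (t ^ 2 + δ) ^ κ ≤ deriv (regPow δ κ) t := by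
  have h0 : 0 < t ^ 2 + δ := by positivity
  rw [deriv_regPow hδ, show (t ^ 2 + δ) ^ κ = (t ^ 2 + δ) ^ (κ - 1) * (t ^ 2 + δ) by
    rw [← Real.rpow_add_one h0.ne', sub_add_cancel], mul_left_comm]
  refine mul_le_mul_of_nonneg_left ?_ (by positivity)
  nlinarith

theorem deriv_regPow_le (hδ : 0 < δ) (hκ : κ ≤ 0) (t : ℝ) :
    deriv (regPow δ κ) t ≤ (t ^ 2 + δ) ^ κ := by
  have h0 : 0 < t ^ 2 + δ := by positivity
  rw [deriv_regPow hδ, show (t ^ 2 + δ) ^ κ = (t ^ 2 + δ) ^ (κ - 1) * (t ^ 2 + δ) by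
    rw [← Real.rpow_add_one h0.ne', sub_add_cancel]]
  refine mul_le_mul_of_nonneg_left ?_ (by positivity)
  nlinarith [sq_nonneg t]

theorem deriv_regPow_nonneg (hδ : 0 < δ) (hκ : κ ≤ 0) (hκ' : -1 / 2 < κ) (t : ℝ) :
    0 ≤ deriv (regPow δ κ) t :=
  le_trans (mul_nonneg (by linarith) (by positivity)) (le_deriv_regPow hδ hκ t)

theorem rpow_sq_add_le (hδ : 0 < δ) (hκ : κ ≤ 0) (t : ℝ) : (t ^ 2 + δ) ^ κ ≤ δ ^ κ :=
  Real.rpow_le_rpow_of_nonpos hδ (by nlinarith [sq_nonneg t]) hκ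

theorem nnnorm_deriv_regPow_le (hδ : 0 < δ) (hκ : κ ≤ 0) (hκ' : -1 / 2 < κ) (t : ℝ) :
    ‖deriv (regPow δ κ) t‖₊ ≤ (δ ^ κ).toNNReal := by
  rw [← NNReal.coe_le_coe, coe_nnnorm, Real.coe_toNNReal _ (by positivity),
    Real.norm_of_nonneg (deriv_regPow_nonneg hδ hκ hκ' t)]
  exact (deriv_regPow_le hδ hκ t).trans (rpow_sq_add_le hδ hκ t)

theorem abs_mul_rpow_sq (t : ℝ) (hκ' : -1 / 2 < κ) :
    |t * (t ^ 2) ^ κ| = |t| ^ (1 + 2 * κ) := by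
  rcases eq_or_ne t 0 with rfl | ht
  · simp [Real.zero_rpow (show 1 + 2 * κ ≠ 0 by linarith)]
  · have h0 : 0 < |t| := abs_pos.2 ht
    rw [abs_mul, abs_of_nonneg (by positivity : (0 : ℝ) ≤ (t ^ 2) ^ κ), ← sq_abs,
      ← Real.rpow_natCast, ← Real.rpow_mul h0.le, Real.rpow_add h0, Real.rpow_one]
    norm_num

theorem abs_regPow_le (hδ : 0 < δ) (hκ : κ ≤ 0) (hκ' : -1 / 2 < κ) (t : ℝ) :
    |regPow δ κ t| ≤ |t| ^ (1 + 2 * κ) := by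
  rw [← abs_mul_rpow_sq t hκ']
  rcases eq_or_ne t 0 with rfl | ht
  · simp
  · rw [regPow, abs_mul, abs_mul, abs_of_nonneg (by positivity : (0 : ℝ) ≤ (t ^ 2) ^ κ),
      abs_of_nonneg (by positivity : (0 : ℝ) ≤ (t ^ 2 + δ) ^ κ)]
    refine mul_le_mul_of_nonneg_left ?_ (abs_nonneg _)
    exact Real.rpow_le_rpow_of_nonpos (by positivity) (by linarith) hκ

theorem tendsto_regPow {d : ℕ → ℝ} (hd : Tendsto d atTop (𝓝 0)) (t : ℝ) :
    Tendsto (fun n => regPow (d n) κ t) atTop (𝓝 (t * (t ^ 2) ^ κ)) := by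
  rcases eq_or_ne t 0 with rfl | ht
  · simp
  · have h1 : Tendsto (fun n => t ^ 2 + d n) atTop (𝓝 (t ^ 2)) := by
      simpa using hd.const_add (t ^ 2)
    exact (h1.rpow_const (Or.inl (by positivity))).const_mul t

end RegularizedPower

/-! ### Energy estimates with power weights. -/

section Estimates

variable {N m : ℕ} {Ω : Set (EuclideanSpace ℝ (Fin N))}
  {X : Fin m → EuclideanSpace ℝ (Fin N) → EuclideanSpace ℝ (Fin N)}
  {A : EuclideanSpace ℝ (Fin N) → Matrix (Fin m) (Fin m) ℝ} {α β γ : ℝ}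
  {f u : EuclideanSpace ℝ (Fin N) → ℝ}
  {g : EuclideanSpace ℝ (Fin N) → EuclideanSpace ℝ (Fin m)}

/-- The energy estimate obtained by testing with a regularized power of the solution. -/
theorem IsWeakSolution.energy_estimate (hX : ∀ j, Continuous (X j)) (hα : 0 < α)
    (hA : IsElliptic Ω α β A) (hw : IsWeakSolution Ω X A f u g) (hγ : 1 / 2 < γ) (hγ1 : γ < 1)
    {p p' : ℝ≥0∞} [p.HolderConjugate p'] (hf : AEStronglyMeasurable f (volume.restrict Ω))
    {δ : ℝ} (hδ : 0 < δ) :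
    ENNReal.ofReal (α * (2 * γ - 1)) *
        ∫⁻ x in Ω, ENNReal.ofReal ((u x ^ 2 + δ) ^ (γ - 1) * ‖g x‖ ^ 2) ≤
      eLpNorm f p (volume.restrict Ω) *
        eLpNorm u (p' * ENNReal.ofReal (2 * γ - 1)) (volume.restrict Ω) ^ (2 * γ - 1) := by
  have hκ : γ - 1 ≤ 0 := by linarith
  have hκ' : -1 / 2 < γ - 1 := by linarith
  have hu := hw.1
  -- For `δ > 0` the derivative of `Φ` is bounded, so `Φ(u)` is an admissible test function.
  set Φ := regPow δ (γ - 1) with hΦ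
  have hv := hu.comp hX one_le_two ENNReal.ofNat_ne_top (contDiff_regPow (κ := γ - 1) hδ)
    (regPow_zero _ _) (nnnorm_deriv_regPow_le hδ hκ hκ')
  have heq := hw.2 _ _ hv
  have hint : Integrable (fun x => (u x ^ 2 + δ) ^ (γ - 1) * ‖g x‖ ^ 2) (volume.restrict Ω) := by
    refine Integrable.bdd_mul (c := δ ^ (γ - 1)) (hu.memLp_grad.integrable_norm_pow two_ne_zero)
      ?_ (Eventually.of_forall fun x => ?_)
    · refine Continuous.comp_aestronglyMeasurable (g := fun t : ℝ => (t ^ 2 + δ) ^ (γ - 1)) ?_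
        hu.memLp_fun.1
      exact Continuous.rpow_const (by fun_prop) fun t => Or.inl (by positivity)
    · rw [Real.norm_of_nonneg (by positivity)]
      exact rpow_sq_add_le hδ hκ _
  have h1 : ∫ x in Ω, α * (2 * γ - 1) * ((u x ^ 2 + δ) ^ (γ - 1) * ‖g x‖ ^ 2) ≤
      ∫ x in Ω, f x * Φ (u x) := by
    rw [← heq]
    refine integral_mono_ae (hint.const_mul _) (hA.integrable hu.memLp_grad hv.memLp_grad) ?_
    filter_upwards [hA.elliptic] with x hx
    have h2 := (hx (g x)).1
    have h3 := le_deriv_regPow hδ hκ (u x)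
    have h4 := deriv_regPow_nonneg hδ hκ hκ' (u x)
    simp only [WithLp.ofLp_smul, dotProduct_smul, smul_eq_mul]
    calc α * (2 * γ - 1) * ((u x ^ 2 + δ) ^ (γ - 1) * ‖g x‖ ^ 2)
        = ((1 + 2 * (γ - 1)) * (u x ^ 2 + δ) ^ (γ - 1)) * (α * ‖g x‖ ^ 2) := by ring
      _ ≤ deriv (regPow δ (γ - 1)) (u x) * ((A x).mulVec (g x).ofLp ⬝ᵥ (g x).ofLp) :=
        mul_le_mul h3 h2 (by positivity) h4
  have h5 : ENNReal.ofReal (α * (2 * γ - 1)) *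
      ∫⁻ x in Ω, ENNReal.ofReal ((u x ^ 2 + δ) ^ (γ - 1) * ‖g x‖ ^ 2) =
      ENNReal.ofReal (∫ x in Ω, α * (2 * γ - 1) * ((u x ^ 2 + δ) ^ (γ - 1) * ‖g x‖ ^ 2)) := by
    rw [integral_const_mul, ENNReal.ofReal_mul (mul_nonneg hα.le (by linarith)),
      ofReal_integral_eq_lintegral_ofReal hint (Eventually.of_forall fun x => by positivity)]
  rw [h5]
  refine (ENNReal.ofReal_le_ofReal h1).trans ?_
  refine (Real.ofReal_le_enorm _).trans ((enorm_integral_le_lintegral_enorm _).trans ?_)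
  rw [← eLpNorm_one_eq_lintegral_enorm]
  refine (eLpNorm_smul_le_mul_eLpNorm (p := p) (q := p') (r := 1) hv.memLp_fun.1 hf).trans ?_
  refine mul_le_mul' le_rfl ?_
  rw [← eLpNorm_norm_rpow u (by linarith : 0 < 2 * γ - 1)]
  refine eLpNorm_mono fun x => ?_
  rw [Real.norm_eq_abs, Real.norm_of_nonneg (by positivity), Real.norm_eq_abs]
  refine (abs_regPow_le hδ hκ hκ' (u x)).trans_eq ?_
  ring_nf

/-- The a priori bound for the solution, linear in the datum. -/
theorem IsWeakSolution.mul_eLpNorm_le (hX : ∀ j, Continuous (X j)) (hα : 0 < α)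
    (hA : IsElliptic Ω α β A) (hw : IsWeakSolution Ω X A f u g) (hγ : 1 / 2 < γ) (hγ1 : γ < 1)
    {p p' s r : ℝ≥0∞} [p.HolderConjugate p'] (hf : AEStronglyMeasurable f (volume.restrict Ω))
    (hr : p' * ENNReal.ofReal (2 * γ - 1) = r) (hsr : s * ENNReal.ofReal γ = r)
    (hur : MemLp u r (volume.restrict Ω)) {S : ℝ≥0}
    (hS : ∀ (u : EuclideanSpace ℝ (Fin N) → ℝ)
      (g : EuclideanSpace ℝ (Fin N) → EuclideanSpace ℝ (Fin m)), MemW0 Ω X 2 u g →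
      eLpNorm u s (volume.restrict Ω) ≤ S * eLpNorm g 2 (volume.restrict Ω)) :
    ENNReal.ofReal (α * (2 * γ - 1)) * eLpNorm u r (volume.restrict Ω) ≤
      S ^ 2 * eLpNorm f p (volume.restrict Ω) := by
  set c := ENNReal.ofReal (α * (2 * γ - 1)) with hc
  have hc0 : c ≠ 0 := by
    have : 0 < α * (2 * γ - 1) := mul_pos hα (by linarith)
    simpa [hc] using this
  have hct : c ≠ ⊤ := ENNReal.ofReal_ne_top
  set I := eLpNorm u r (volume.restrict Ω) with hI
  set F := eLpNorm f p (volume.restrict Ω) with hF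
  -- Since `2 κ = γ - 1`, the squared gradient of `regPow δ κ (u)` is at most the weighted energy
  -- density, while `1 + 2 κ = γ` is the power of `|u|` that survives as `δ → 0`.
  set κ := (γ - 1) / 2 with hκdef
  have hκ : κ ≤ 0 := by rw [hκdef]; linarith
  have hκ' : -1 / 2 < κ := by rw [hκdef]; linarith
  have hκγ : 1 + 2 * κ = γ := by rw [hκdef]; ring
  have hu := hw.1
  set D := S ^ 2 * (F * I ^ (2 * γ - 1)) / c with hD
  have hbound : ∀ δ : ℝ, 0 < δ →
      eLpNorm (fun x => regPow δ κ (u x)) s (volume.restrict Ω) ≤ D ^ (1 / 2 : ℝ) := by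
    intro δ hδ
    have hv := hu.comp hX one_le_two ENNReal.ofNat_ne_top (contDiff_regPow (κ := κ) hδ)
      (regPow_zero _ _) (nnnorm_deriv_regPow_le hδ hκ hκ')
    have h1 := hw.energy_estimate hX hα hA hγ hγ1 (p := p) (p' := p') hf hδ
    rw [hr] at h1
    refine (hS _ _ hv).trans ?_
    have h2 : eLpNorm (fun x => deriv (regPow δ κ) (u x) • g x) 2 (volume.restrict Ω) ≤
        (∫⁻ x in Ω, ENNReal.ofReal ((u x ^ 2 + δ) ^ (γ - 1) * ‖g x‖ ^ 2)) ^ (1 / 2 : ℝ) := by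
      rw [eLpNorm_eq_lintegral_rpow_enorm_toReal (by norm_num) (by norm_num)]
      simp only [ENNReal.toReal_ofNat]
      refine ENNReal.rpow_le_rpow (lintegral_mono fun x => ?_) (by norm_num)
      rw [← ofReal_norm, ENNReal.ofReal_rpow_of_nonneg (norm_nonneg _) (by norm_num)]
      refine ENNReal.ofReal_le_ofReal ?_
      have h3 := deriv_regPow_le hδ hκ (u x)
      have h4 := deriv_regPow_nonneg hδ hκ hκ' (u x)
      have h5 : (0 : ℝ) < u x ^ 2 + δ := by positivity
      rw [Real.rpow_two, norm_smul, Real.norm_of_nonneg h4, mul_pow,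
        show γ - 1 = κ * 2 by rw [hκdef]; ring, Real.rpow_mul h5.le, Real.rpow_two]
      gcongr
    refine (mul_le_mul' le_rfl h2).trans ?_
    set J := ∫⁻ x in Ω, ENNReal.ofReal ((u x ^ 2 + δ) ^ (γ - 1) * ‖g x‖ ^ 2) with hJ
    have h6 : (S : ℝ≥0∞) = ((S : ℝ≥0∞) ^ 2) ^ (1 / 2 : ℝ) := by
      rw [← ENNReal.rpow_natCast, ← ENNReal.rpow_mul]
      norm_num
    rw [h6, ← ENNReal.mul_rpow_of_nonneg _ _ (by norm_num)]
    refine ENNReal.rpow_le_rpow ?_ (by norm_num)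
    rw [hD, ENNReal.le_div_iff_mul_le (Or.inl hc0) (Or.inl hct), mul_assoc]
    exact mul_le_mul' le_rfl (by rwa [mul_comm])
  -- The bound does not depend on `δ`, so Fatou's lemma along `δ = 1 / (n + 1)` removes the
  -- regularization.
  have hlim : I ^ γ ≤ D ^ (1 / 2 : ℝ) := by
    have h1 : eLpNorm (fun x => u x * (u x ^ 2) ^ κ) s (volume.restrict Ω) ≤ D ^ (1 / 2 : ℝ) :=
      Lp.eLpNorm_le_of_ae_tendsto (u := atTop)
        (f := fun (n : ℕ) x => regPow (1 / ((n : ℝ) + 1)) κ (u x))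
        (Eventually.of_forall fun n => hbound _ (by positivity))
        (fun n => (contDiff_regPow (κ := κ) (by positivity)).continuous.comp_aestronglyMeasurable
          hu.memLp_fun.1)
        (Eventually.of_forall fun x => tendsto_regPow tendsto_one_div_add_atTop_nhds_zero_nat _)
    have h2 : eLpNorm (fun x => u x * (u x ^ 2) ^ κ) s (volume.restrict Ω) = I ^ γ := by
      rw [hI, ← hsr, ← eLpNorm_norm_rpow u (by linarith : 0 < γ)]
      refine eLpNorm_congr_norm_ae (Eventually.of_forall fun x => ?_)
      rw [Real.norm_eq_abs, abs_mul_rpow_sq _ hκ', hκγ, Real.norm_of_nonneg (by positivity),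
        Real.norm_eq_abs]
    rwa [h2] at h1
  have h2 : I ^ (2 * γ) ≤ D := by
    have h3 := ENNReal.rpow_le_rpow hlim (z := 2) (by norm_num)
    rw [← ENNReal.rpow_mul, ← ENNReal.rpow_mul] at h3
    norm_num at h3
    rwa [mul_comm] at h3
  rw [hD, ENNReal.le_div_iff_mul_le (Or.inl hc0) (Or.inl hct)] at h2
  -- Dividing by `I ^ (2 γ - 1)` requires `I` nonzero and finite; finiteness is the assumption
  -- `hur`.
  rcases eq_or_ne I 0 with h0 | h0
  · simp [h0]
  have hIt : I ≠ ⊤ := hur.2.ne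
  have hP0 : I ^ (2 * γ - 1) ≠ 0 := by simp [ENNReal.rpow_eq_zero_iff, h0, hIt]
  have hPt : I ^ (2 * γ - 1) ≠ ⊤ := ENNReal.rpow_ne_top_of_nonneg (by linarith) hIt
  refine (ENNReal.mul_le_mul_iff_left hP0 hPt).1 ?_
  calc c * I * I ^ (2 * γ - 1) = I ^ (2 * γ) * c := by
        rw [mul_assoc, show 2 * γ = 1 + (2 * γ - 1) by ring, ENNReal.rpow_add _ _ h0 hIt,
          ENNReal.rpow_one, mul_comm]
        ring_nf
    _ ≤ S ^ 2 * (F * I ^ (2 * γ - 1)) := h2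
    _ = _ := by rw [mul_assoc]

/-- The a priori bound for the gradient. -/
theorem IsWeakSolution.eLpNorm_grad_le (hX : ∀ j, Continuous (X j)) (hα : 0 < α)
    (hA : IsElliptic Ω α β A) (hw : IsWeakSolution Ω X A f u g) (hγ : 1 / 2 < γ) (hγ1 : γ < 1)
    {p p' r t q : ℝ≥0∞} [p.HolderConjugate p'] [t.HolderTriple 2 q]
    (hf : AEStronglyMeasurable f (volume.restrict Ω))
    (hr : p' * ENNReal.ofReal (2 * γ - 1) = r) (htr : t * ENNReal.ofReal (1 - γ) = r)
    (hr1 : 1 ≤ r) :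
    eLpNorm g q (volume.restrict Ω) ≤
      (eLpNorm u r (volume.restrict Ω) +
        eLpNorm (fun _ : EuclideanSpace ℝ (Fin N) => (1 : ℝ)) r (volume.restrict Ω)) ^ (1 - γ) *
      (eLpNorm f p (volume.restrict Ω) * eLpNorm u r (volume.restrict Ω) ^ (2 * γ - 1) /
        ENNReal.ofReal (α * (2 * γ - 1))) ^ (1 / 2 : ℝ) := by
  have hu := hw.1
  -- Taking `δ = 1` keeps `u² + δ` away from zero, so `g` factors as a weight in `L^t` times a
  -- weighted gradient in `L²`. The price is the norm of the constant `1` in the bound, which is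
  -- thus not homogeneous.
  have h1 := hw.energy_estimate hX hα hA hγ hγ1 (p := p) (p' := p') hf one_pos
  rw [hr] at h1
  have hc : 0 < α * (2 * γ - 1) := mul_pos hα (by linarith)
  have hpos : ∀ x, 0 < u x ^ 2 + 1 := fun x => by positivity
  have hcont : ∀ e : ℝ, AEStronglyMeasurable (fun x => (u x ^ 2 + 1) ^ e) (volume.restrict Ω) := by
    intro e
    refine Continuous.comp_aestronglyMeasurable (g := fun t : ℝ => (t ^ 2 + 1) ^ e) ?_
      hu.memLp_fun.1
    exact Continuous.rpow_const (by fun_prop) fun t => Or.inl (by positivity)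
  have hsplit : g = (fun x => (u x ^ 2 + 1) ^ ((1 - γ) / 2)) •
      fun x => (u x ^ 2 + 1) ^ ((γ - 1) / 2) • g x := by
    ext1 x
    simp only [Pi.smul_apply']
    rw [smul_smul, ← Real.rpow_add (hpos x), show (1 - γ) / 2 + (γ - 1) / 2 = 0 by ring,
      Real.rpow_zero, one_smul]
  conv_lhs => rw [hsplit]
  refine (eLpNorm_smul_le_mul_eLpNorm (p := t) (q := 2) (r := q)
    ((hcont _).smul hu.memLp_grad.1) (hcont _)).trans (mul_le_mul' ?_ ?_)
  · have h2 : eLpNorm (fun x => (u x ^ 2 + 1) ^ ((1 - γ) / 2)) t (volume.restrict Ω) ≤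
        eLpNorm (fun x => ‖|u x| + 1‖ ^ (1 - γ)) t (volume.restrict Ω) := by
      refine eLpNorm_mono fun x => ?_
      have h3 : (0 : ℝ) ≤ |u x| + 1 := by positivity
      rw [Real.norm_of_nonneg (by positivity), Real.norm_of_nonneg (by positivity),
        Real.norm_of_nonneg h3, show (1 - γ) / 2 = (1 / 2) * (1 - γ) by ring,
        Real.rpow_mul (hpos x).le]
      refine Real.rpow_le_rpow (by positivity) ?_ (by linarith)
      rw [← Real.sqrt_eq_rpow]
      refine Real.sqrt_le_iff.2 ⟨h3, ?_⟩
      nlinarith [sq_abs (u x), abs_nonneg (u x)]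
    refine h2.trans ?_
    rw [eLpNorm_norm_rpow _ (by linarith : 0 < 1 - γ), htr]
    refine ENNReal.rpow_le_rpow ?_ (by linarith)
    refine (eLpNorm_add_le hu.memLp_fun.1.norm aestronglyMeasurable_const hr1).trans ?_
    exact add_le_add (eLpNorm_norm u).le le_rfl
  · rw [eLpNorm_eq_lintegral_rpow_enorm_toReal (by norm_num) (by norm_num)]
    simp only [ENNReal.toReal_ofNat]
    refine ENNReal.rpow_le_rpow ?_ (by norm_num)
    rw [ENNReal.le_div_iff_mul_le (Or.inl (by simpa using hc)) (Or.inl ENNReal.ofReal_ne_top),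
      mul_comm]
    refine le_trans (mul_le_mul' le_rfl (lintegral_mono fun x => ?_)) h1
    rw [← ofReal_norm, ENNReal.ofReal_rpow_of_nonneg (norm_nonneg _) (by norm_num)]
    refine ENNReal.ofReal_le_ofReal (le_of_eq ?_)
    rw [Real.rpow_two, Pi.smul_apply', norm_smul,
      Real.norm_of_nonneg (by have := hpos x; positivity), mul_pow,
      ← Real.rpow_natCast ((u x ^ 2 + 1) ^ ((γ - 1) / 2)), ← Real.rpow_mul (hpos x).le]
    norm_num

end Estimates

end XElliptic

namespace XElliptic

/-! ### Truncations of the datum. -/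

section Truncation

theorem abs_trunc_le_abs {k : ℝ} (hk : 0 ≤ k) (s : ℝ) : |trunc k s| ≤ |s| := by
  rcases le_total 0 s with h | h
  · rw [abs_of_nonneg h, abs_le]
    exact ⟨(by linarith : -s ≤ 0).trans (le_max_of_le_right (le_min h hk)),
      max_le (by linarith) (min_le_left _ _)⟩
  · rw [abs_of_nonpos h, abs_le]
    refine ⟨?_, max_le (by linarith) ((min_le_left _ _).trans (by linarith))⟩
    rw [neg_neg]
    exact le_max_of_le_right (le_min le_rfl (h.trans hk))

theorem abs_trunc_le {k : ℝ} (hk : 0 ≤ k) (s : ℝ) : |trunc k s| ≤ k :=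
  abs_le.2 ⟨le_max_left _ _, max_le (by linarith) (min_le_right _ _)⟩

theorem trunc_of_abs_le {k s : ℝ} (h : |s| ≤ k) : trunc k s = s := by
  rw [abs_le] at h
  rw [trunc, min_eq_left h.2, max_eq_right h.1]

theorem continuous_trunc (k : ℝ) : Continuous (trunc k) :=
  continuous_const.max (continuous_id.min continuous_const)

theorem tendsto_trunc (s : ℝ) : Tendsto (fun n : ℕ => trunc n s) atTop (𝓝 s) := by
  refine tendsto_const_nhds.congr' ?_
  obtain ⟨n, hn⟩ := exists_nat_ge |s|
  filter_upwards [eventually_ge_atTop n] with k hk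
  exact (trunc_of_abs_le (hn.trans (by exact_mod_cast hk))).symm

variable {α : Type*} [MeasurableSpace α] {μ : Measure α} {f : α → ℝ}

theorem aestronglyMeasurable_trunc (hf : AEStronglyMeasurable f μ) (k : ℝ) :
    AEStronglyMeasurable (fun x => trunc k (f x)) μ :=
  (continuous_trunc k).comp_aestronglyMeasurable hf

theorem memLp_trunc [IsFiniteMeasure μ] (hf : AEStronglyMeasurable f μ) {k : ℝ} (hk : 0 ≤ k)
    (q : ℝ≥0∞) : MemLp (fun x => trunc k (f x)) q μ :=
  MemLp.of_bound (aestronglyMeasurable_trunc hf k) k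
    (Eventually.of_forall fun x => abs_trunc_le hk (f x))

theorem tendsto_eLpNorm_trunc_sub {q : ℝ≥0∞} (hq0 : q ≠ 0) (hq : q ≠ ⊤) (hf : MemLp f q μ) :
    Tendsto (fun n : ℕ => eLpNorm (fun x => trunc n (f x) - f x) q μ) atTop (𝓝 0) := by
  refine tendsto_eLpNorm_zero_of_dominated hq0 hq
    (fun n => (aestronglyMeasurable_trunc hf.1 n).sub hf.1) (hf.norm.const_mul 2)
    (fun n => Eventually.of_forall fun x => ?_) (Eventually.of_forall fun x => ?_)
  · have h1 := abs_trunc_le_abs (Nat.cast_nonneg n) (f x)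
    have h2 := norm_sub_le (trunc n (f x)) (f x)
    simp only [Real.norm_eq_abs, abs_mul, abs_abs, Nat.abs_ofNat] at h2 ⊢
    linarith
  · simpa using (tendsto_trunc (f x)).sub_const (f x)

end Truncation

/-! ### Cauchy sequences, change of exponent and weak limits in Lebesgue spaces. -/

section Limits

variable {α E : Type*} [MeasurableSpace α] {μ : Measure α} [NormedAddCommGroup E]

theorem exists_limit_of_tendsto_eLpNorm_sub [CompleteSpace E] {q : ℝ≥0∞} (hq : 1 ≤ q)
    {f : ℕ → α → E} (hf : ∀ n, MemLp (f n) q μ)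
    (h : Tendsto (fun z : ℕ × ℕ => eLpNorm (f z.1 - f z.2) q μ) atTop (𝓝 0)) :
    ∃ g, MemLp g q μ ∧ Tendsto (fun n => eLpNorm (fun x => f n x - g x) q μ) atTop (𝓝 0) := by
  have : Fact (1 ≤ q) := ⟨hq⟩
  have hc : CauchySeq fun n => (hf n).toLp := by
    refine EMetric.cauchySeq_iff.2 fun ε hε => ?_
    obtain ⟨z, hz⟩ := eventually_atTop.1 (h.eventually (gt_mem_nhds hε))
    refine ⟨max z.1 z.2, fun n hn k hk => ?_⟩
    rw [Lp.edist_toLp_toLp]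
    exact hz (n, k) ⟨(le_max_left _ _).trans hn, (le_max_right _ _).trans hk⟩
  obtain ⟨G, hG⟩ := cauchySeq_tendsto_of_complete hc
  refine ⟨G, Lp.memLp G, ?_⟩
  refine ((Lp.tendsto_Lp_iff_tendsto_eLpNorm' _ _).1 hG).congr fun n => eLpNorm_congr_ae ?_
  filter_upwards [(hf n).coeFn_toLp] with x hx
  simp [hx]

theorem tendsto_eLpNorm_of_exponent_le [IsFiniteMeasure μ] {q r : ℝ≥0∞} (hq0 : q ≠ 0)
    (hr : r ≠ ⊤) (hqr : q ≤ r) {f : ℕ → α → E} (hf : ∀ n, AEStronglyMeasurable (f n) μ)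
    (h : Tendsto (fun n => eLpNorm (f n) r μ) atTop (𝓝 0)) :
    Tendsto (fun n => eLpNorm (f n) q μ) atTop (𝓝 0) := by
  have hfin : μ Set.univ ^ (1 / q.toReal - 1 / r.toReal) ≠ ⊤ := by
    refine ENNReal.rpow_ne_top_of_nonneg ?_ (measure_ne_top _ _)
    have hq' : 0 < q.toReal := ENNReal.toReal_pos hq0 (ne_top_of_le_ne_top hr hqr)
    exact sub_nonneg.2 (one_div_le_one_div_of_le hq' (ENNReal.toReal_mono hr hqr))
  have h5 := ENNReal.Tendsto.mul_const h (Or.inr hfin)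
  rw [zero_mul] at h5
  exact tendsto_of_tendsto_of_tendsto_of_le_of_le tendsto_const_nhds h5
    (fun _ => zero_le) fun n => eLpNorm_le_eLpNorm_mul_rpow_measure_univ hqr (hf n)

theorem tendsto_integral_inner_of_tendsto_eLpNorm [InnerProductSpace ℝ E] {q q' : ℝ≥0∞}
    [q.HolderConjugate q'] {f : ℕ → α → E} {g h : α → E} (hf : ∀ n, MemLp (f n) q μ)
    (hg : MemLp g q μ) (hh : MemLp h q' μ)
    (hlim : Tendsto (fun n => eLpNorm (fun x => f n x - g x) q μ) atTop (𝓝 0)) :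
    Tendsto (fun n => ∫ x, inner ℝ (f n x) (h x) ∂μ) atTop (𝓝 (∫ x, inner ℝ (g x) (h x) ∂μ)) := by
  refine tendsto_integral_of_L1 _ (integrable_inner_of_memLp (p := q) (q := q') hg hh).1
    (Eventually.of_forall fun n => integrable_inner_of_memLp (p := q) (q := q') (hf n) hh) ?_
  have h5 := ENNReal.Tendsto.mul_const hlim (Or.inr hh.2.ne)
  rw [zero_mul] at h5
  refine tendsto_of_tendsto_of_tendsto_of_le_of_le tendsto_const_nhds h5
    (fun _ => zero_le) fun n => ?_
  simp only [← inner_sub_left]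
  rw [← eLpNorm_one_eq_lintegral_enorm]
  have := eLpNorm_le_eLpNorm_mul_eLpNorm_of_nnnorm (p := q) (q := q') (r := 1) ((hf n).sub hg).1 hh.1
    (fun a b => inner ℝ a b) 1 (Eventually.of_forall fun x => by
      rw [one_mul]
      exact nnnorm_inner_le_nnnorm _ _)
  rw [ENNReal.coe_one, one_mul] at this
  exact this

end Limits

/-! ### The a priori estimates with matched exponents. -/

section APriori

variable {N m : ℕ} {U Ω : Set (EuclideanSpace ℝ (Fin N))}
  {X : Fin m → EuclideanSpace ℝ (Fin N) → EuclideanSpace ℝ (Fin N)} {Q p α : ℝ}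

/-- All constants are fixed before `β` and `A`, since only the lower ellipticity bound enters the
energy estimate. The gradient bound is needed only for small data, to show that differences tend to
zero, so the power `1 / 2` is harmless. -/
theorem GeometricAssumptions.exists_apriori (hX : GeometricAssumptions U Ω X Q) (hN : 2 ≤ N)
    (hQ : 2 < Q) (hU : IsOpen U) (hΩ : IsOpen Ω) (hΩb : Bornology.IsBounded Ω)
    (hΩU : closure Ω ⊆ U) (hp1 : 1 < p) (hp2 : p < 2 * Q / (Q + 2)) (hα : 0 < α) :
    ∃ (S C : ℝ≥0) (K : ℝ≥0∞), K ≠ ⊤ ∧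
      (∀ (u : EuclideanSpace ℝ (Fin N) → ℝ)
        (g : EuclideanSpace ℝ (Fin N) → EuclideanSpace ℝ (Fin m)), MemW0 Ω X 2 u g →
        eLpNorm u 2 (volume.restrict Ω) ≤ S * eLpNorm g 2 (volume.restrict Ω)) ∧
      ∀ (β : ℝ) (A : EuclideanSpace ℝ (Fin N) → Matrix (Fin m) (Fin m) ℝ), IsElliptic Ω α β A →
      ∀ (f u : EuclideanSpace ℝ (Fin N) → ℝ)
        (g : EuclideanSpace ℝ (Fin N) → EuclideanSpace ℝ (Fin m)),
        AEStronglyMeasurable f (volume.restrict Ω) → IsWeakSolution Ω X A f u g →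
        MemLp u (ENNReal.ofReal (p * Q / (Q - 2 * p))) (volume.restrict Ω) ∧
        eLpNorm u (ENNReal.ofReal (p * Q / (Q - 2 * p))) (volume.restrict Ω) ≤
          C * eLpNorm f (ENNReal.ofReal p) (volume.restrict Ω) ∧
        (eLpNorm f (ENNReal.ofReal p) (volume.restrict Ω) ≤ 1 →
          eLpNorm g (ENNReal.ofReal (p * Q / (Q - p))) (volume.restrict Ω) ≤
            K * eLpNorm f (ENNReal.ofReal p) (volume.restrict Ω) ^ (1 / 2 : ℝ)) := by
  have : IsFiniteMeasure (volume.restrict Ω) := ⟨by simpa using hΩb.measure_lt_top⟩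
  have hQ2 : 0 < Q - 2 := by linarith
  have hp0 : 0 < p := by linarith
  have hpQ : p * (Q + 2) < 2 * Q := (lt_div_iff₀ (by linarith)).1 hp2
  have hQ2p : 0 < Q - 2 * p := by nlinarith
  have hQp : 0 < Q - p := by linarith
  obtain ⟨σ, hσ⟩ : ∃ σ, σ = 2 * Q / (Q - 2) := ⟨_, rfl⟩
  obtain ⟨P, hP⟩ : ∃ P, P = p * Q / (Q - 2 * p) := ⟨_, rfl⟩
  rw [← hP]
  -- This `γ` solves `σ γ = p' (2 γ - 1)`, and the common value is `P`.
  obtain ⟨γ, hγdef⟩ : ∃ γ, γ = p * (Q - 2) / (2 * (Q - 2 * p)) := ⟨_, rfl⟩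
  have hγ : 1 / 2 < γ := by
    rw [hγdef, div_lt_div_iff₀ two_pos (by positivity)]
    nlinarith
  have hγ1 : γ < 1 := by
    rw [hγdef, div_lt_one (by positivity)]
    nlinarith
  have hσ2 : 2 ≤ σ := by
    rw [hσ, le_div_iff₀ hQ2]
    linarith
  have hσγ : σ * γ = P := by
    rw [hσ, hγdef, hP]
    field_simp
  have hp'γ : p / (p - 1) * (2 * γ - 1) = P := by
    have hp1' : p - 1 ≠ 0 := by linarith
    have h2γ : 2 * γ - 1 = Q * (p - 1) / (Q - 2 * p) := by
      have hγ' : γ * (2 * (Q - 2 * p)) = p * (Q - 2) := by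
        rw [hγdef, div_mul_cancel₀ _ (by positivity)]
      rw [eq_div_iff hQ2p.ne']
      linear_combination hγ'
    rw [h2γ, hP, div_mul_div_comm, div_eq_div_iff (mul_ne_zero hp1' hQ2p.ne') hQ2p.ne']
    ring
  have hP1 : 1 ≤ P := by
    rw [hP, le_div_iff₀ hQ2p]
    nlinarith
  have hPσ : P ≤ σ := by
    rw [← hσγ]
    nlinarith
  have hconj : (ENNReal.ofReal p).HolderConjugate (ENNReal.ofReal (p / (p - 1))) :=
    (Real.HolderConjugate.conjExponent hp1).ennrealOfReal
  -- The identity behind it is `(1 - γ) / P + 1 / 2 = (Q - p) / (p Q)`.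
  have htriple : (ENNReal.ofReal (P / (1 - γ))).HolderTriple 2
      (ENNReal.ofReal (p * Q / (Q - p))) := ⟨by
    have h1γ : 0 < 1 - γ := by linarith
    rw [← ENNReal.ofReal_ofNat 2, ← ENNReal.ofReal_inv_of_pos (by positivity),
      ← ENNReal.ofReal_inv_of_pos (by norm_num), ← ENNReal.ofReal_inv_of_pos (by positivity),
      ← ENNReal.ofReal_add (by positivity) (by norm_num)]
    congr 1
    have hγ' : γ * (2 * (Q - 2 * p)) = p * (Q - 2) := by
      rw [hγdef, div_mul_cancel₀ _ (by positivity)]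
    rw [inv_div, inv_div, hP, div_div_eq_mul_div, inv_eq_one_div,
      div_add_div _ _ (by positivity) two_ne_zero,
      div_eq_div_iff (by positivity) (by positivity)]
    linear_combination (-(p * Q)) * hγ'⟩
  have hr : ENNReal.ofReal (p / (p - 1)) * ENNReal.ofReal (2 * γ - 1) = ENNReal.ofReal P := by
    rw [← ENNReal.ofReal_mul (div_nonneg hp0.le (by linarith)), hp'γ]
  have hsr : ENNReal.ofReal σ * ENNReal.ofReal γ = ENNReal.ofReal P := by
    rw [← ENNReal.ofReal_mul (by positivity), hσγ]
  have htr : ENNReal.ofReal (P / (1 - γ)) * ENNReal.ofReal (1 - γ) = ENNReal.ofReal P := by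
    rw [← ENNReal.ofReal_mul (div_nonneg (by linarith) (by linarith)),
      div_mul_cancel₀ _ (by linarith)]
  obtain ⟨S, hS₀⟩ := hX.sobolev_contDiff hN hQ hU hΩ hΩb hΩU
  rw [← hσ] at hS₀
  have hS : ∀ (u : EuclideanSpace ℝ (Fin N) → ℝ)
      (g : EuclideanSpace ℝ (Fin N) → EuclideanSpace ℝ (Fin m)), MemW0 Ω X 2 u g →
      eLpNorm u (ENNReal.ofReal σ) (volume.restrict Ω) ≤ S * eLpNorm g 2 (volume.restrict Ω) :=
    fun u g hu => hu.sobolev hX.continuous one_le_two hS₀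
  have hσ2' : 2 ≤ ENNReal.ofReal σ := by
    rw [← ENNReal.ofReal_ofNat 2]
    exact ENNReal.ofReal_le_ofReal hσ2
  have hc : 0 < α * (2 * γ - 1) := mul_pos hα (by linarith)
  set c := ENNReal.ofReal (α * (2 * γ - 1)) with hcdef
  have hc0 : c ≠ 0 := by simpa [hcdef] using hc
  set C : ℝ≥0 := S ^ 2 / (α * (2 * γ - 1)).toNNReal with hC
  have hCc : (C : ℝ≥0∞) = S ^ 2 / c := by
    rw [hC, ENNReal.coe_div (by simpa using hc), ENNReal.coe_pow]
    rfl
  set V := (volume.restrict Ω) Set.univ ^ (1 / (2 : ℝ≥0∞).toReal - 1 / (ENNReal.ofReal σ).toReal)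
    with hV
  have hVt : V ≠ ⊤ := by
    refine ENNReal.rpow_ne_top_of_nonneg (sub_nonneg.2 ?_) (measure_ne_top _ _)
    exact one_div_le_one_div_of_le (by norm_num)
      (ENNReal.toReal_mono ENNReal.ofReal_ne_top hσ2')
  set M := eLpNorm (fun _ : EuclideanSpace ℝ (Fin N) => (1 : ℝ)) (ENNReal.ofReal P)
    (volume.restrict Ω) with hM
  have hMt : M ≠ ⊤ := (memLp_const (1 : ℝ)).2.ne
  refine ⟨S * V.toNNReal, C, ((C : ℝ≥0∞) + M) ^ (1 - γ) * ((C : ℝ≥0∞) ^ (2 * γ - 1) / c) ^ (1 / 2 : ℝ), ?_, ?_, ?_⟩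
  · refine ENNReal.mul_ne_top (ENNReal.rpow_ne_top_of_nonneg (by linarith)
      (ENNReal.add_ne_top.2 ⟨ENNReal.coe_ne_top, hMt⟩))
      (ENNReal.rpow_ne_top_of_nonneg (by norm_num) (ENNReal.div_ne_top ?_ hc0))
    exact ENNReal.rpow_ne_top_of_nonneg (by linarith) ENNReal.coe_ne_top
  · intro u g hu
    rw [ENNReal.coe_mul, ENNReal.coe_toNNReal hVt, mul_right_comm]
    exact (eLpNorm_le_eLpNorm_mul_rpow_measure_univ hσ2' hu.memLp_fun.1).trans
      (mul_le_mul' (hS u g hu) le_rfl)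
  · intro β A hA f u g hf hw
    have huσ : MemLp u (ENNReal.ofReal σ) (volume.restrict Ω) := ⟨hw.1.memLp_fun.1,
      (hS u g hw.1).trans_lt (ENNReal.mul_lt_top ENNReal.coe_lt_top hw.1.memLp_grad.2)⟩
    -- Qualitative membership in `L^P`, from `P ≤ σ` and finite measure, is what allows the division
    -- in `IsWeakSolution.mul_eLpNorm_le`.
    have huP := huσ.mono_exponent (ENNReal.ofReal_le_ofReal hPσ)
    have hle : eLpNorm u (ENNReal.ofReal P) (volume.restrict Ω) ≤
        C * eLpNorm f (ENNReal.ofReal p) (volume.restrict Ω) := by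
      have h1 := hw.mul_eLpNorm_le hX.continuous hα hA hγ hγ1 (p := ENNReal.ofReal p)
        (p' := ENNReal.ofReal (p / (p - 1))) hf hr hsr huP hS
      rw [hCc, ← ENNReal.mul_div_right_comm,
        ENNReal.le_div_iff_mul_le (Or.inl hc0) (Or.inl ENNReal.ofReal_ne_top), mul_comm]
      exact h1
    refine ⟨huP, hle, fun hf1 => ?_⟩
    have h1 := hw.eLpNorm_grad_le hX.continuous hα hA hγ hγ1 (p := ENNReal.ofReal p)
      (p' := ENNReal.ofReal (p / (p - 1))) (q := ENNReal.ofReal (p * Q / (Q - p))) hf hr htr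
      (ENNReal.one_le_ofReal.2 hP1)
    -- For data of norm at most `1`, every factor except one `‖f‖_p` under the square root is
    -- bounded by a constant.
    have hle1 : eLpNorm u (ENNReal.ofReal P) (volume.restrict Ω) ≤ C :=
      hle.trans (mul_le_of_le_one_right' hf1)
    refine h1.trans ?_
    rw [mul_assoc, ← ENNReal.mul_rpow_of_nonneg _ _ (by norm_num : (0 : ℝ) ≤ 1 / 2)]
    refine mul_le_mul' (ENNReal.rpow_le_rpow (add_le_add hle1 le_rfl) (by linarith))
      (ENNReal.rpow_le_rpow ?_ (by norm_num))
    rw [mul_comm ((C : ℝ≥0∞) ^ (2 * γ - 1) / c), ← mul_div_assoc]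
    exact ENNReal.div_le_div_right
      (mul_le_mul' le_rfl (ENNReal.rpow_le_rpow hle1 (by linarith))) _

end APriori

end XElliptic

/-! ### Existence, uniqueness and the estimate. -/

open XElliptic in
theorem theorem4p4 {N m : ℕ} (hN : 2 ≤ N)
    (U Ω : Set (EuclideanSpace ℝ (Fin N))) (hU : IsOpen U) (hΩ : IsOpen Ω)
    (hΩb : Bornology.IsBounded Ω) (hΩU : closure Ω ⊆ U)
    (X : Fin m → EuclideanSpace ℝ (Fin N) → EuclideanSpace ℝ (Fin N))
    (Q : ℝ) (hQ : 2 < Q) (hX : XElliptic.GeometricAssumptions U Ω X Q)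
    (p : ℝ) (hp1 : 1 < p) (hp2 : p < 2 * Q / (Q + 2)) (α : ℝ) (hα : 0 < α) :
    ∃ C : ℝ≥0, ∀ (β : ℝ), α < β →
      ∀ A : EuclideanSpace ℝ (Fin N) → Matrix (Fin m) (Fin m) ℝ, XElliptic.IsElliptic Ω α β A →
      ∀ f : EuclideanSpace ℝ (Fin N) → ℝ,
        MemLp f (ENNReal.ofReal p) (volume.restrict Ω) →
        ∃ u : EuclideanSpace ℝ (Fin N) → ℝ,
          XElliptic.IsSolutionByApproximation Ω X Q A f u ∧
          (∀ v, XElliptic.IsSolutionByApproximation Ω X Q A f v →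
            v =ᵐ[volume.restrict Ω] u) ∧
          MemLp u (ENNReal.ofReal (p * Q / (Q - 2 * p))) (volume.restrict Ω) ∧
          eLpNorm u (ENNReal.ofReal (p * Q / (Q - 2 * p))) (volume.restrict Ω)
            ≤ C * eLpNorm f (ENNReal.ofReal p) (volume.restrict Ω) := by
  have : IsFiniteMeasure (volume.restrict Ω) := ⟨by simpa using hΩb.measure_lt_top⟩
  obtain ⟨S, C, K, hK, hS, hap⟩ := hX.exists_apriori hN hQ hU hΩ hΩb hΩU hp1 hp2 hα
  have hpQ : p * (Q + 2) < 2 * Q := (lt_div_iff₀ (by linarith)).1 hp2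
  have hQ2p : 0 < Q - 2 * p := by nlinarith
  obtain ⟨P, hP⟩ : ∃ P, P = p * Q / (Q - 2 * p) := ⟨_, rfl⟩
  obtain ⟨r, hr⟩ : ∃ r, r = p * Q / (Q - p) := ⟨_, rfl⟩
  rw [← hP, ← hr] at hap
  rw [← hP]
  have hQ0 : 0 < Q := by linarith
  -- This and the next inequality both reduce to `Q² (p - 1) ≥ 0`: the two exponents in the
  -- definition are the values of `p**` and `p*` at `p = 1`.
  have hsP : Q / (Q - 2) ≤ P := by
    rw [hP, div_le_div_iff₀ (by linarith) hQ2p]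
    linarith [mul_pos (pow_pos hQ0 2) (sub_pos.2 hp1)]
  have hqr : Q / (Q - 1) ≤ r := by
    rw [hr, div_le_div_iff₀ (by linarith) (by linarith)]
    linarith [mul_pos (pow_pos hQ0 2) (sub_pos.2 hp1)]
  have hr2 : r ≤ 2 := by
    rw [hr, div_le_iff₀ (by linarith)]
    linarith
  have hrP : r ≤ P := by
    rw [hr, hP]
    exact div_le_div_of_nonneg_left (by positivity) hQ2p (by linarith)
  have hr1 : 1 ≤ r := le_trans (by rw [le_div_iff₀ (by linarith)]; linarith) hqr
  have hr2' : ENNReal.ofReal r ≤ 2 := by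
    rw [← ENNReal.ofReal_ofNat 2]
    exact ENNReal.ofReal_le_ofReal hr2
  have hr1' : 1 ≤ ENNReal.ofReal r := ENNReal.one_le_ofReal.2 hr1
  have hP1' : 1 ≤ ENNReal.ofReal P := ENNReal.one_le_ofReal.2 (hr1.trans hrP)
  have hp1' : 1 ≤ ENNReal.ofReal p := ENNReal.one_le_ofReal.2 hp1.le
  refine ⟨C, fun β _ A hA f hf => ?_⟩
  set F : ℕ → EuclideanSpace ℝ (Fin N) → ℝ := fun n x => trunc n (f x) with hF
  have hF2 : ∀ n, MemLp (F n) 2 (volume.restrict Ω) := fun n =>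
    memLp_trunc hf.1 n.cast_nonneg 2
  have hFp : ∀ n, MemLp (F n) (ENNReal.ofReal p) (volume.restrict Ω) := fun n =>
    memLp_trunc hf.1 n.cast_nonneg _
  choose un gn hw using fun n => exists_isWeakSolution hX.continuous hα hA hS (hF2 n)
  have hd : Tendsto (fun z : ℕ × ℕ => eLpNorm (fun x => F z.1 x - F z.2 x) (ENNReal.ofReal p)
      (volume.restrict Ω)) atTop (𝓝 0) := by
    have h0 := tendsto_eLpNorm_trunc_sub (by positivity) ENNReal.ofReal_ne_top hf
    have h1 := (h0.comp tendsto_fst).add (h0.comp tendsto_snd)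
    rw [prod_atTop_atTop_eq, add_zero] at h1
    refine tendsto_of_tendsto_of_tendsto_of_le_of_le tendsto_const_nhds h1
      (fun _ => zero_le) fun z => ?_
    have h2 := eLpNorm_sub_le (f := fun x => F z.1 x - f x) (g := fun x => F z.2 x - f x)
      ((hFp z.1).sub hf).1 ((hFp z.2).sub hf).1 hp1'
    refine le_trans (eLpNorm_congr_ae (Eventually.of_forall fun x => ?_)).le h2
    simp
  have hsub : ∀ z : ℕ × ℕ, IsWeakSolution Ω X A (fun x => F z.1 x - F z.2 x)
      (fun x => un z.1 x - un z.2 x) (fun x => gn z.1 x - gn z.2 x) := fun z =>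
    (hw z.1).sub hX.continuous hA (hF2 z.1) (hF2 z.2) (hw z.2)
  -- The a priori bounds are applied to differences of approximate solutions, whose data tend to
  -- zero in `L^p`.
  have hapd := fun z : ℕ × ℕ => hap β A hA _ _ _ ((hF2 z.1).sub (hF2 z.2)).1 (hsub z)
  have hunP : ∀ n, MemLp (un n) (ENNReal.ofReal P) (volume.restrict Ω) := fun n =>
    (hap β A hA _ _ _ (hF2 n).1 (hw n)).1
  have hwr : ∀ n, MemW0 Ω X (ENNReal.ofReal r) (un n) (gn n) := fun n =>
    (hw n).1.mono_exponent hX.continuous hr2' (by positivity)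
  obtain ⟨u, huP, hu⟩ := exists_limit_of_tendsto_eLpNorm_sub hP1' hunP <| by
    have h1 := ENNReal.Tendsto.const_mul (a := (C : ℝ≥0∞)) hd (Or.inr ENNReal.coe_ne_top)
    rw [mul_zero] at h1
    exact tendsto_of_tendsto_of_tendsto_of_le_of_le tendsto_const_nhds h1
      (fun _ => zero_le) fun z => (hapd z).2.1
  obtain ⟨g, hgr, hg⟩ := exists_limit_of_tendsto_eLpNorm_sub hr1' (fun n => (hwr n).memLp_grad) <| by
    have h1 := ENNReal.Tendsto.const_mul (a := K) ((ENNReal.continuous_rpow_const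
      (y := (1 / 2 : ℝ))).tendsto 0 |>.comp hd) (Or.inr hK)
    rw [ENNReal.zero_rpow_of_pos (by norm_num), mul_zero] at h1
    refine tendsto_of_tendsto_of_tendsto_of_le_of_le' tendsto_const_nhds h1
      (Eventually.of_forall fun _ => zero_le) ?_
    -- The gradient bound is available only once the data differ by at most `1` in `L^p`.
    filter_upwards [hd.eventually (ge_mem_nhds one_pos)] with z hz
    exact (hapd z).2.2 hz
  refine ⟨u, ⟨un, gn, g, id, hw, strictMono_id, fun s hs1 hs => ?_, fun q hq1 hq => ?_⟩,
    ?_, huP, ?_⟩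
  · exact tendsto_eLpNorm_of_exponent_le (by positivity) ENNReal.ofReal_ne_top
      (ENNReal.ofReal_le_ofReal (hs.le.trans hsP)) (fun n => ((hunP n).sub huP).1) hu
  · have hqr' := ENNReal.ofReal_le_ofReal (hq.le.trans hqr)
    have hq0 : ENNReal.ofReal q ≠ 0 := by positivity
    have hgq := tendsto_eLpNorm_of_exponent_le hq0 ENNReal.ofReal_ne_top hqr'
      (fun n => ((hwr n).memLp_grad.sub hgr).1) hg
    have huq := tendsto_eLpNorm_of_exponent_le hq0 ENNReal.ofReal_ne_top
      (hqr'.trans (ENNReal.ofReal_le_ofReal hrP)) (fun n => ((hunP n).sub huP).1) hu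
    have hwq : ∀ n, MemW0 Ω X (ENNReal.ofReal q) (un n) (gn n) := fun n =>
      (hwr n).mono_exponent hX.continuous hqr' hq0
    refine ⟨MemW0.of_tendsto hX.continuous (ENNReal.one_le_ofReal.2 hq1) hwq
      (huP.mono_exponent (hqr'.trans (ENNReal.ofReal_le_ofReal hrP))) (hgr.mono_exponent hqr')
      huq hgq, fun q' hconj h hh => ?_⟩
    exact tendsto_integral_inner_of_tendsto_eLpNorm (q := ENNReal.ofReal q) (q' := q')
      (fun n => (hwq n).memLp_grad) (hgr.mono_exponent hqr') hh hgq
  · rintro v ⟨un', gn', g', ψ, hw', hψ, hs', hq'⟩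
    -- The difference of two weak solutions with the same datum solves the problem with datum zero,
    -- so the linear bound makes it vanish.
    have heq : ∀ n, un' n =ᵐ[volume.restrict Ω] un n := fun n => by
      have h1 := hap β A hA _ _ _ ((hF2 n).sub (hF2 n)).1
        ((hw' n).sub hX.continuous hA (hF2 n) (hF2 n) (hw n))
      have h2 := h1.2.1
      rw [sub_self] at h2
      rw [eLpNorm_zero, mul_zero, nonpos_iff_eq_zero,
        eLpNorm_eq_zero_iff h1.1.1 (by positivity)] at h2
      filter_upwards [h2] with x hx
      exact sub_eq_zero.1 hx
    have hv := (hq' 1 le_rfl (by rw [lt_div_iff₀ (by linarith)]; linarith)).1.memLp_fun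
    have h1 := hs' 1 le_rfl (by rw [lt_div_iff₀ (by linarith)]; linarith)
    -- The sequence converges to `v` in `L¹` and to `u` in `L^P`; convergence in measure is common
    -- to both, and its limit is unique.
    have h2 : TendstoInMeasure (volume.restrict Ω) (fun n => un (ψ n)) atTop v := by
      refine tendstoInMeasure_of_tendsto_eLpNorm (p := ENNReal.ofReal 1) (by simp)
        (fun n => (hunP _).1) hv.1 (h1.congr fun n => eLpNorm_congr_ae ?_)
      filter_upwards [heq (ψ n)] with x hx
      simp [hx]
    have h3 : TendstoInMeasure (volume.restrict Ω) (fun n => un (ψ n)) atTop u :=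
      tendstoInMeasure_of_tendsto_eLpNorm (p := ENNReal.ofReal P) (by positivity)
        (fun n => (hunP _).1) huP.1 (hu.comp hψ.tendsto_atTop)
    exact tendstoInMeasure_ae_unique h2 h3
  · have h1 := hu.add_const (C * eLpNorm f (ENNReal.ofReal p) (volume.restrict Ω))
    rw [zero_add] at h1
    refine ge_of_tendsto' h1 fun n => ?_
    have h2 := eLpNorm_sub_le (f := un n) (g := fun x => un n x - u x) (hunP n).1
      ((hunP n).sub huP).1 hP1'
    refine (eLpNorm_congr_ae (Eventually.of_forall fun x => ?_)).le.trans
      (h2.trans ?_)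
    · simp
    · rw [add_comm]
      refine add_le_add le_rfl ((hap β A hA _ _ _ (hF2 n).1 (hw n)).2.1.trans
        (mul_le_mul' le_rfl (eLpNorm_mono fun x => ?_)))
      exact abs_trunc_le_abs n.cast_nonneg (f x)
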